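/- **Theorem (Convergence property of DSGD-CECA).** *Problem.* Let $n\ge 2$ agents minimize $f(x)=\frac1n\sum_{i=1}^n f_i(x)$ over $x\in\mathbb R^d$, where $f_i(x)=\mathbb E_{\xi\sim\mathcal D_i}F(x;\xi)$ and $f$ is bounded below, $f^\star=\inf f$. Assume, for constants $L>0$ and $\sigma,b\ge 0$: (1) each $f_i$ is differentiable with $\|\nabla f_i(x)-\nabla f_i(y)\|\le L\|x-y\|$ for all $x,y$; (2) $\mathbb E_{\xi\sim\mathcal D_i}\nabla F(x;\xi)=\nabla f_i(x)$ and $\mathbb E_{\xi\sim\mathcal D_i}\|\nabla F(x;\xi)-\nabla f_i(x)\|^2\le\sigma^2$ for all $i,x$; (3) $\frac1n\sum_{i=1}^n\|\nabla f_i(x)-\nabla f(x)\|^2\le b^2$ for all $x$. The samples $\xi_i^{(k)}\sim\mathcal D_i$ ($k\ge0$, $1\le i\le n$) are mutually independent and independent of the random initial point $x^{(0)}$. *Algorithm.* Let $\tau=\lceil\log_2 n\rceil$, let $n-1=(\delta_0\delta_1\cdots\delta_{\tau-1})_2$ with most significant bit $\delta_0$, and let $n_0=0$, $n_{r+1}=2n_r+\delta_r$.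 Agent indices are read modulo $n$ in $\{1,\dots,n\}$. For $0\le r<\tau$ let $Q^{(r)}\in\{0,1\}^{n\times n}$ be the following matrix. In the 2-port model, $Q^{(r)}_{ij}=1$ iff $i-j\equiv n_r+\delta_r \pmod n$. In the 1-port model ($n$ even), $Q^{(r)}_{ij}=1$ iff $j\equiv i+2n_r+1\pmod n$ for odd $i$, and iff $j\equiv i-2n_r-1\pmod n$ for even $i$. All agents start from $x_i^{(0)}=y_i^{(0)}=x^{(0)}$. In iteration $k$ put $r=k \bmod \tau$; let $z^{(k)}=x^{(k)}$ if $\delta_r=1$ and $z^{(k)}=y^{(k)}$ if $\delta_r=0$; let $e_i^{(k)}=\nabla F(z_i^{(k)};\xi_i^{(k)})$; let $(a,c)=\left(\frac12,\frac{n_r}{2n_r+1}\right)$ if $\delta_r=1$ and $(a,c)=\left(\frac{n_r+1}{2n_r+1},\frac12\right)$ if $\delta_r=0$. A DSGD-CECA iteration with step size $\gamma$ is $$x_i^{(k+1)}=a\,(x_i^{(k)}-\gamma e_i^{(k)})+(1-a)\sum_j Q^{(r)}_{ij}(z_j^{(k)}-\gamma e_j^{(k)}),$$ $$y_i^{(k+1)}=c\,(y_i^{(k)}-\gamma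 e_i^{(k)})+(1-c)\sum_j Q^{(r)}_{ij}(z_j^{(k)}-\gamma e_j^{(k)}).$$ A global averaging iteration is $x_i^{(k+1)}=\frac1n\sum_j(x_j^{(k)}-\gamma e_j^{(k)})$, $y_i^{(k+1)}=\frac1n\sum_j(y_j^{(k)}-\gamma e_j^{(k)})$ for all $i$. The iterations $k<s$ are global averaging iterations and the iterations $k\ge s$ are DSGD-CECA iterations, where $s=\tau$ (the statement also holds for $s=\tau-1$); in both cases $x_i^{(k)}$ and $y_i^{(k)}$ do not depend on $i$ for $0\le k<\tau$. Let $\bar x^{(k)}=\frac1n\sum_i x_i^{(k)}$. *Claim.* Let $T\ge 0$ be an integer, suppose that $\mathbb E|f(\bar x^{(0)})|<\infty$ and $\Delta:=\mathbb E f(\bar x^{(0)})-f^\star>0$, and let $$\gamma=\frac{1}{\left(\frac{2n\Delta}{L\sigma^2(T+1)}\right)^{-1/2}+\left(\frac{\Delta}{24L^2\tau^2(\sigma^2+2b^2)(T+1)}\right)^{-1/3}+8\tau L},$$ where a summand of the denominator that contains a division by $0$ (which happens if $\sigma=0$, or $\sigma=b=0$) is read as $0$. Then, for every $n\ge2$ in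 the 2-port model and for every even $n\ge 2$ in the 1-port model, $\mathbb E\|\nabla f(\bar x^{(k)})\|^2<\infty$ for $k\le T$ and $$\frac1{T+1}\sum_{k=0}^T\mathbb E\|\nabla f(\bar x^{(k)})\|^2\le 16\left(\frac{\Delta L\sigma^2}{n(T+1)}\right)^{1/2}+24\left(\frac{\Delta^2L^2\tau^2(\sigma^2+2b^2)}{(T+1)^2}\right)^{1/3}+\frac{32\tau\Delta L}{T+1}.$$ Moreover the number of transient iterations is $O(n^3\log_2^4 n)=\tilde O(n^3)$: if $\sigma>0$, there is a constant $C>0$ depending only on $L,\sigma,b,\Delta$ such that, whenever $T\ge C\,n^3(\log_2 n)^4$, the sum of the second and the third term on the right is at most the first one, so that the left side is at most $32\left(\frac{\Delta L\sigma^2}{n(T+1)}\right)^{1/2}$. -/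

import Mathlib

open MeasureTheory ProbabilityTheory

namespace DSGDCECA

/-! ### The combinatorial data of the communication-optimal exact consensus algorithm -/

/-- The number of rounds `τ = ⌈log₂ n⌉`. -/
def tau (n : ℕ) : ℕ := Nat.clog 2 n

/-- The bit `δ_r`, `0 ≤ r < τ`, of `n - 1 = (δ_0 δ_1 ⋯ δ_{τ-1})₂`, most significant bit first. -/
def bit (n r : ℕ) : ℕ := (n - 1) / 2 ^ (tau n - 1 - r) % 2

/-- The numbers `n_0 = 0`, `n_{r+1} = 2 n_r + δ_r`. -/
def nSeq (n : ℕ) : ℕ → ℕ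
  | 0 => 0
  | r + 1 => 2 * nSeq n r + bit n r

/-- The two communication models. -/
inductive PortModel
  | onePort
  | twoPort

/-- The numbers of agents allowed: any for the 2-port model, even ones for the 1-port model. -/
def PortModel.Allows : PortModel → ℕ → Prop
  | .onePort, n => Even n
  | .twoPort, _ => True

open Classical in
/-- The communication matrix `Q^(r)`. The agents are `1, …, n`, agent numbers being read modulo
`n`; the index `i : Fin n` stands for the agent with number `i + 1`. -/
noncomputable def commMatrix (n : ℕ) (r : ℕ) : PortModel → Matrix (Fin n) (Fin n) ℝ
  | .twoPort => fun i j =>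
      if bit n r = 1 then
        if (i : ℤ) - (j : ℤ) ≡ (nSeq n r : ℤ) + 1 [ZMOD n] then 1 else 0
      else
        if (i : ℤ) - (j : ℤ) ≡ (nSeq n r : ℤ) [ZMOD n] then 1 else 0
  | .onePort => fun i j =>
      if Odd ((i : ℕ) + 1) then
        if (j : ℤ) ≡ (i : ℤ) + 2 * (nSeq n r : ℤ) + 1 [ZMOD n] then 1 else 0
      else
        if (j : ℤ) ≡ (i : ℤ) - 2 * (nSeq n r : ℤ) - 1 [ZMOD n] then 1 else 0

/-- The weight `a` used in a round `r`. -/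
noncomputable def weightA (n r : ℕ) : ℝ :=
  if bit n r = 1 then 1 / 2 else ((nSeq n r : ℝ) + 1) / (2 * (nSeq n r : ℝ) + 1)

/-- The weight `b` used in a round `r`. -/
noncomputable def weightB (n r : ℕ) : ℝ :=
  if bit n r = 1 then (nSeq n r : ℝ) / (2 * (nSeq n r : ℝ) + 1) else 1 / 2

/-! ### The stochastic optimization problem -/

/-- The model space `ℝ^d` with the Euclidean norm. -/
abbrev Vec (d : ℕ) : Type := EuclideanSpace ℝ (Fin d)

/-- A distributed stochastic problem: a loss `F(x; ξ)` and the data distributions `D_i` of the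
`n` agents. -/
structure Problem (n d : ℕ) (Ξ : Type*) [MeasurableSpace Ξ] where
  /-- the loss `F(x; ξ)` -/
  F : Vec d → Ξ → ℝ
  /-- the data distribution of agent `i` -/
  D : Fin n → Measure Ξ

namespace Problem

variable {n d : ℕ} {Ξ : Type*} [MeasurableSpace Ξ]

/-- `f_i(x) = E_{ξ ∼ D_i} F(x; ξ)`. -/
noncomputable def localObj (p : Problem n d Ξ) (i : Fin n) (x : Vec d) : ℝ :=
  ∫ u, p.F x u ∂(p.D i)

/-- `f(x) = (1/n) ∑ f_i(x)`. -/
noncomputable def obj (p : Problem n d Ξ) (x : Vec d) : ℝ :=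
  (1 / (n : ℝ)) * ∑ i, p.localObj i x

/-- `f⋆ = inf f`. -/
noncomputable def fStar (p : Problem n d Ξ) : ℝ := ⨅ x, p.obj x

/-- The stochastic gradient `∇F(x; ξ)`, the gradient in `x`. -/
noncomputable def stochGrad (p : Problem n d Ξ) (x : Vec d) (u : Ξ) : Vec d :=
  gradient (fun x' => p.F x' u) x

/-- What is needed for the problem to make sense: the `D_i` are probability distributions,
the expectations defining the `f_i` exist, `∇F(x; ξ)` exists for almost every `ξ` and is
measurable in `(x, ξ)`, and `f` is bounded below. -/
structure WellPosed (p : Problem n d Ξ) : Prop where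
  isProb : ∀ i, IsProbabilityMeasure (p.D i)
  integrable : ∀ i x, Integrable (p.F x) (p.D i)
  differentiable : ∀ i x, ∀ᵐ u ∂(p.D i), DifferentiableAt ℝ (fun x' => p.F x' u) x
  measurable : Measurable (fun q : Vec d × Ξ => p.stochGrad q.1 q.2)
  bddBelow : BddBelow (Set.range p.obj)

/-- Each `f_i` is `L`-smooth. -/
structure LipschitzSmooth (p : Problem n d Ξ) (L : ℝ) : Prop where
  differentiable : ∀ i, Differentiable ℝ (p.localObj i)
  lipschitz : ∀ i x y,
    ‖gradient (p.localObj i) x - gradient (p.localObj i) y‖ ≤ L * ‖x - y‖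

/-- Stochastic gradients are square integrable, unbiased, with variance at most `σ²`. -/
structure GradientNoise (p : Problem n d Ξ) (σ : ℝ) : Prop where
  memLp : ∀ i x, MemLp (p.stochGrad x) 2 (p.D i)
  unbiased : ∀ i x, ∫ u, p.stochGrad x u ∂(p.D i) = gradient (p.localObj i) x
  variance : ∀ i x,
    ∫ u, ‖p.stochGrad x u - gradient (p.localObj i) x‖ ^ 2 ∂(p.D i) ≤ σ ^ 2

/-- Data heterogeneity bounded by `b²`. -/
def DataHeterogeneity (p : Problem n d Ξ) (b : ℝ) : Prop :=
  ∀ x, (1 / (n : ℝ)) * ∑ i, ‖gradient (p.localObj i) x - gradient p.obj x‖ ^ 2 ≤ b ^ 2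

/-- The randomness of the algorithm: `ξ k i` is the sample drawn by agent `i` at iteration `k`;
it has law `D_i`, all samples are mutually independent, and they are independent of the random
initial point `x₀`. -/
structure Sampling {Ω : Type*} [MeasurableSpace Ω] (p : Problem n d Ξ) (P : Measure Ω)
    (ξ : ℕ → Fin n → Ω → Ξ) (x₀ : Ω → Vec d) : Prop where
  measurable_init : Measurable x₀
  measurable_sample : ∀ k i, Measurable (ξ k i)
  law : ∀ k i, P.map (ξ k i) = p.D i
  indep : iIndepFun (fun q : ℕ × Fin n => ξ q.1 q.2) P
  indep_init : IndepFun x₀ (fun ω (q : ℕ × Fin n) => ξ q.1 q.2 ω) P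

end Problem

/-! ### The algorithm -/

/-- The average of the rows of an `n × d` array. -/
noncomputable def mean {n d : ℕ} (v : Fin n → Vec d) : Vec d :=
  (1 / (n : ℝ)) • ∑ i, v i

/-- The models `x_i` and the auxiliary models `y_i` of all the agents. -/
structure State (n d : ℕ) where
  /-- the local models -/
  x : Fin n → Vec d
  /-- the auxiliary models -/
  y : Fin n → Vec d

section Algorithm

variable {n d : ℕ} {Ξ : Type*} [MeasurableSpace Ξ]

/-- The array `z` in round `r`: it is `x` if `δ_r = 1` and `y` if `δ_r = 0`. -/
def zArray (r : ℕ) (S : State n d) : Fin n → Vec d :=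
  if bit n r = 1 then S.x else S.y

/-- The array `e` of stochastic gradients `∇F(z_i; ξ_i)`. -/
noncomputable def eArray (p : Problem n d Ξ) (r : ℕ) (u : Fin n → Ξ) (S : State n d) :
    Fin n → Vec d :=
  fun i => p.stochGrad (zArray r S i) (u i)

/-- One iteration of DSGD-CECA with communication matrix `Q^(r)`. -/
noncomputable def cecaStep (p : Problem n d Ξ) (m : PortModel) (γ : ℝ) (r : ℕ) (u : Fin n → Ξ)
    (S : State n d) : State n d where
  x := fun i => weightA n r • (S.x i - γ • eArray p r u S i) +
    (1 - weightA n r) •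
      ∑ j, commMatrix n r m i j • (zArray r S j - γ • eArray p r u S j)
  y := fun i => weightB n r • (S.y i - γ • eArray p r u S i) +
    (1 - weightB n r) •
      ∑ j, commMatrix n r m i j • (zArray r S j - γ • eArray p r u S j)

/-- One stochastic gradient step followed by an exact global averaging. -/
noncomputable def averagingStep (p : Problem n d Ξ) (γ : ℝ) (r : ℕ) (u : Fin n → Ξ)
    (S : State n d) : State n d where
  x := fun _ => mean (fun j => S.x j - γ • eArray p r u S j)
  y := fun _ => mean (fun j => S.y j - γ • eArray p r u S j)

/-- The iterates `(x^(k), y^(k))` for a given realization `u` of the samples: all models start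
at `x₀`, the iterations `k < s` use global averaging, and the iterations `k ≥ s` are DSGD-CECA
iterations, with `r = k mod τ`. -/
noncomputable def iterates (p : Problem n d Ξ) (m : PortModel) (γ : ℝ) (s : ℕ)
    (u : ℕ → Fin n → Ξ) (x₀ : Vec d) : ℕ → State n d
  | 0 => ⟨fun _ => x₀, fun _ => x₀⟩
  | k + 1 =>
      if k < s then averagingStep p γ (k % tau n) (u k) (iterates p m γ s u x₀ k)
      else cecaStep p m γ (k % tau n) (u k) (iterates p m γ s u x₀ k)

end Algorithm

/-! ### The step size and the three terms of the rate -/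

/-- The step size `γ`. When `σ = 0` (or `σ² + 2b² = 0`) the corresponding summand of the
denominator is `0`, in agreement with the limit `t ^ (-1/2) → 0` as `t → ∞`. -/
noncomputable def stepSize (n T : ℕ) (L σ b Δ : ℝ) : ℝ :=
  1 / ((2 * n * Δ / (L * σ ^ 2 * (T + 1))) ^ (-(1 / 2) : ℝ)
    + (Δ / (24 * L ^ 2 * (tau n : ℝ) ^ 2 * (σ ^ 2 + 2 * b ^ 2) * (T + 1))) ^ (-(1 / 3) : ℝ)
    + 8 * tau n * L)

/-- The linear speedup term `(Δ L σ² / (n (T+1)))^{1/2}`. -/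
noncomputable def speedupTerm (n T : ℕ) (L σ Δ : ℝ) : ℝ :=
  (Δ * L * σ ^ 2 / (n * (T + 1))) ^ (1 / 2 : ℝ)

/-- The term `(Δ² L² τ² (σ² + 2 b²) / (T+1)²)^{1/3}`. -/
noncomputable def middleTerm (n T : ℕ) (L σ b Δ : ℝ) : ℝ :=
  (Δ ^ 2 * L ^ 2 * (tau n : ℝ) ^ 2 * (σ ^ 2 + 2 * b ^ 2) / (T + 1) ^ 2) ^ (1 / 3 : ℝ)

/-- The term `τ Δ L / (T+1)`. -/
noncomputable def lastTerm (n T : ℕ) (L Δ : ℝ) : ℝ :=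
  tau n * Δ * L / (T + 1)

end DSGDCECA

namespace DSGDCECA

/-! ### The combinatorics of the rounds -/

/-! The average model performs SGD with the mean of the agents' stochastic gradients, taken at query
points `z_i` near the average. It remains to bound the consensus error `z_i - x̄` and run the usual
argument for smooth nonconvex SGD.

Consensus: under communication alone, after `r` rounds `x_i` is the mean over a cyclic block of `n_r
+ 1` agents beginning at `i`, and `y_i` the mean over the `n_r` agents that follow `i`; each round
glues the partner's block to one's own (`evolve_eq_sum`). Since `n_τ + 1 = n`, a full cycle
annihilates a zero-sum `x`, and the next round discards the old `y` (`transmitted_evolve_eq_zero`).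
Rounds are also nonexpansive (`pairNorm_mix_le`). Restarting the dynamics one to two cycles before
`k` bounds the deviation by `γ` times the norms of the centred gradients of the last `2τ` iterations
(`arrayNorm_transmitted_le_sum`); no spectral gap is needed.

Stochastics: each gradient error is orthogonal to whatever the initial point and the other samples
up to that iteration determine, so averaging leaves variance `σ² / n` in `descent`. Centred
gradients cost `L²` times the consensus error plus `b² + σ²`, which gives a recursive inequality
(`consensus_error_le`). Summed over time it closes because `8 γ τ L ≤ 1` (`sum_consensus_le`).

Rate: telescoping the descent leaves `2Δ / (γ (T+1)) + 15 γ² τ² L² (b² + σ²) + L γ σ² / n`. Each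
summand of `1 / γ` controls one of the competing terms (`stepSize_bounds`), and comparing powers of
the three rate terms gives the transient time (`speedupTerm_dominates`). -/

theorem tau_pos {n : ℕ} (hn : 2 ≤ n) : 0 < tau n := Nat.clog_pos (by norm_num) hn

/-- The recursion reads the binary digits of `n - 1` from the top, so `n_r` is `n - 1` without its
last `τ - r` digits; `n ≤ 2 ^ τ` makes the empty prefix zero. -/
theorem nSeq_eq_div {n : ℕ} (hn : 2 ≤ n) {r : ℕ} (hr : r ≤ tau n) :
    nSeq n r = (n - 1) / 2 ^ (tau n - r) := by
  induction r with
  | zero =>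
    have h : n ≤ 2 ^ tau n := Nat.le_pow_clog (by norm_num) n
    simp only [nSeq, Nat.sub_zero]
    exact (Nat.div_eq_of_lt (by omega)).symm
  | succ r ih =>
    have h1 : tau n - r = (tau n - (r + 1)) + 1 := by omega
    have h2 : tau n - 1 - r = tau n - (r + 1) := by omega
    rw [nSeq, ih (by omega), bit, h1, h2, pow_succ, ← Nat.div_div_eq_div_mul]
    omega

theorem nSeq_tau {n : ℕ} (hn : 2 ≤ n) : nSeq n (tau n) = n - 1 := by
  simp [nSeq_eq_div hn le_rfl]

/-- Minimality of `τ` gives `2 ^ (τ - 1) < n`, so the leading digit is nonzero. Hence round `0`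
always transmits `x`, which lets a new cycle forget the old `y`. -/
theorem bit_zero {n : ℕ} (hn : 2 ≤ n) : bit n 0 = 1 := by
  have h1 : nSeq n 1 = (n - 1) / 2 ^ (tau n - 1) := nSeq_eq_div hn (tau_pos hn)
  have h2 : bit n 0 = nSeq n 1 := by simp [nSeq]
  have h3 : 2 ^ (tau n - 1) < n := by
    have := Nat.pow_pred_clog_lt_self (b := 2) (by norm_num) (x := n) hn
    simpa [tau] using this
  have h4 : 0 < (n - 1) / 2 ^ (tau n - 1) := Nat.div_pos (by omega) (by positivity)
  have h5 : bit n 0 < 2 := Nat.mod_lt _ (by norm_num)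
  omega

theorem bit_eq_zero_of_ne_one {n r : ℕ} (h : bit n r ≠ 1) : bit n r = 0 := by
  have h5 : bit n r < 2 := Nat.mod_lt _ (by norm_num)
  omega

/-- The index congruent to a given integer. -/
def residue (n : ℕ) [NeZero n] (t : ℤ) : Fin n :=
  ⟨(t % n).toNat, by
    have h0 : (0 : ℤ) < n := by exact_mod_cast NeZero.pos n
    have h1 := Int.emod_nonneg t h0.ne'
    have h2 := Int.emod_lt_of_pos t h0
    omega⟩

/-! ### Cyclic indices, partners and blocks of agents -/

section Residue

variable {n : ℕ} [NeZero n]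

theorem coe_residue (t : ℤ) : ((residue n t : ℕ) : ℤ) = t % n := by
  have h0 : (0 : ℤ) < n := by exact_mod_cast NeZero.pos n
  exact Int.toNat_of_nonneg (Int.emod_nonneg t h0.ne')

theorem residue_eq_iff {t : ℤ} {j : Fin n} : residue n t = j ↔ (j : ℤ) ≡ t [ZMOD n] := by
  rw [Fin.ext_iff, ← Int.natCast_inj, coe_residue, Int.ModEq,
    Int.emod_eq_of_lt (a := (j : ℤ)) (by positivity) (by exact_mod_cast j.2), eq_comm]

theorem residue_eq_residue_iff {s t : ℤ} : residue n s = residue n t ↔ s ≡ t [ZMOD n] := by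
  rw [residue_eq_iff, coe_residue]
  exact ⟨fun h => ((Int.mod_modEq t n).symm.trans h).symm, fun h => (Int.mod_modEq t n).trans h.symm⟩

theorem residue_coe (i : Fin n) : residue n i = i := residue_eq_iff.2 rfl

theorem residue_residue_add (s t : ℤ) : residue n ((residue n s : ℕ) + t) = residue n (s + t) := by
  rw [residue_eq_residue_iff, coe_residue]
  exact (Int.mod_modEq s n).add_right t

theorem even_residue_iff (hn : Even n) (t : ℤ) : Even (residue n t : ℕ) ↔ Even t := by
  rw [← Int.even_coe_nat, coe_residue, Int.even_iff, Int.even_iff,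
    Int.emod_emod_of_dvd t (by exact_mod_cast hn.two_dvd)]

theorem residue_injective_of_injOn (i s : ℤ) (hs : s = 1 ∨ s = -1) :
    Function.Injective (fun j : Fin n => residue n (i + s * (j : ℕ))) := by
  intro j k h
  have h1 : i + s * (j : ℕ) ≡ i + s * (k : ℕ) [ZMOD n] := residue_eq_residue_iff.1 h
  have h2 : ((j : ℕ) : ℤ) ≡ (k : ℕ) [ZMOD n] := by
    have h3 := (Int.ModEq.add_left_cancel' i h1).mul_left s
    rcases hs with rfl | rfl <;> simpa using h3
  rw [← residue_coe j, ← residue_coe k]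
  exact residue_eq_residue_iff.2 h2

/-- A walk of `n` unit steps around the cycle visits every agent once, so a block of length `n` is
the whole network. -/
theorem sum_range_residue {M : Type*} [AddCommMonoid M] (f : Fin n → M) (i s : ℤ)
    (hs : s = 1 ∨ s = -1) :
    ∑ j ∈ Finset.range n, f (residue n (i + s * (j : ℕ))) = ∑ j, f j := by
  rw [Finset.sum_range]
  exact (Finite.injective_iff_bijective.1 (residue_injective_of_injOn i s hs)).sum_comp f

/-- The direction in which the information of agent `i` comes. -/
def direction (m : PortModel) (i : ℕ) : ℤ :=
  match m with
  | .twoPort => -1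
  | .onePort => if Even i then 1 else -1

theorem direction_eq (m : PortModel) (i : ℕ) : direction m i = 1 ∨ direction m i = -1 := by
  cases m
  · by_cases h : Even i <;> simp [direction, h]
  · simp [direction]

/-- The agent from which agent `i` receives in round `r`. -/
def partner (n : ℕ) [NeZero n] (r : ℕ) (m : PortModel) (i : Fin n) : Fin n :=
  residue n (i + direction m i *
    match m with
    | .twoPort => nSeq n r + bit n r
    | .onePort => 2 * nSeq n r + 1)

theorem sum_commMatrix_smul {V : Type*} [AddCommGroup V] [Module ℝ V] (r : ℕ) (m : PortModel)
    (v : Fin n → V) (i : Fin n) :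
    ∑ j, commMatrix n r m i j • v j = v (partner n r m i) := by
  have key : ∀ j, commMatrix n r m i j = if partner n r m i = j then 1 else 0 := by
    intro j
    have hsub : ∀ c : ℤ, ((i : ℤ) - (j : ℤ) ≡ c [ZMOD n]) ↔ ((j : ℤ) ≡ i - c [ZMOD n]) := by
      intro c
      rw [Int.modEq_iff_dvd, Int.modEq_iff_dvd, ← dvd_neg]
      ring_nf
    unfold partner
    simp only [residue_eq_iff]
    cases m with
    | twoPort =>
      by_cases hb : bit n r = 1
      · simp only [commMatrix, hb, if_true, hsub, direction]
        congr 2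
        push_cast; ring
      · simp only [commMatrix, bit_eq_zero_of_ne_one hb, hsub, direction]
        simp only [zero_ne_one, if_false]
        congr 2
        push_cast; ring
    | onePort =>
      by_cases he : Even (i : ℕ)
      · have ho : Odd ((i : ℕ) + 1) := he.add_one
        simp only [commMatrix, ho, he, if_true, direction]
        congr 2
        ring
      · have ho : ¬ Odd ((i : ℕ) + 1) := by
          rw [Nat.not_odd_iff_even]; exact (Nat.not_even_iff_odd.1 he).add_one
        simp only [commMatrix, ho, he, if_false, direction]
        congr 2
        ring
  simp [key]

/-- For even `n`, parity survives reduction modulo `n` and the odd offset `2 n_r + 1` flips it: in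
the 1-port model partners face each other. In the 2-port model all agents face the same way. -/
theorem direction_partner {m : PortModel} (hm : m.Allows n) (r : ℕ) (i : Fin n) :
    direction m (partner n r m i) =
      match m with
      | .twoPort => direction m i
      | .onePort => -direction m i := by
  cases m with
  | twoPort => rfl
  | onePort =>
    have hn : Even n := hm
    by_cases he : Even (i : ℕ)
    · have : ¬ Even (partner n r .onePort i : ℕ) := by
        rw [partner, even_residue_iff hn]
        have : Even ((i : ℕ) : ℤ) := by exact_mod_cast he
        simp [direction, he, Int.even_add, this]
      simp only [direction, this, he, if_true, if_false]
    · have : Even (partner n r .onePort i : ℕ) := by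
        rw [partner, even_residue_iff hn]
        have : ¬ Even ((i : ℕ) : ℤ) := by exact_mod_cast he
        simp only [direction, he, if_false, Int.even_add, this]
        simp only [neg_mul, one_mul, false_iff, Int.not_even_iff_odd]
        exact ⟨-nSeq n r - 1, by ring⟩
      simp only [direction, this, he, if_true, if_false, neg_neg]

theorem partner_bijective {m : PortModel} (hm : m.Allows n) (r : ℕ) :
    Function.Bijective (partner n r m) := by
  cases m with
  | twoPort =>
    refine Finite.injective_iff_bijective.1 fun i j h => ?_
    have h1 := Int.ModEq.add_right_cancel' _ (residue_eq_residue_iff.1 h)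
    rw [← residue_coe i, ← residue_coe j]
    exact residue_eq_residue_iff.2 h1
  | onePort =>
    -- Partners use the same offset in opposite directions, so each is the partner of the other.
    refine Function.Involutive.bijective fun i => ?_
    have h := direction_partner hm r i
    simp only at h
    conv_lhs => rw [partner, h]
    rw [partner, residue_residue_add]
    conv_rhs => rw [← residue_coe i]
    congr 1
    ring

/-- The agents heard by the partner continue the block of agents heard so far. -/
theorem sum_partner_x {M : Type*} [AddCommMonoid M] {m : PortModel} (hm : m.Allows n) {r : ℕ}
    (hb : bit n r = 1) (f : Fin n → M) (i : Fin n) :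
    ∑ j ∈ Finset.range (nSeq n r + 1),
        f (residue n (partner n r m i + direction m (partner n r m i) * (j : ℕ))) =
      ∑ j ∈ Finset.range (nSeq n r + 1),
        f (residue n (i + direction m i * ((nSeq n r + 1 + j : ℕ) : ℤ))) := by
  have h := direction_partner hm r i
  cases m with
  | twoPort =>
    refine Finset.sum_congr rfl fun j _ => ?_
    simp only at h
    rw [h, partner, residue_residue_add]
    congr 2
    push_cast [hb]; ring
  | onePort =>
    simp only at h
    -- The partner faces `i`, so its block is the next segment read backwards.
    rw [h, ← Finset.sum_range_reflect]
    refine Finset.sum_congr rfl fun j hj => ?_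
    rw [Finset.mem_range] at hj
    rw [partner, residue_residue_add]
    congr 2
    push_cast [show nSeq n r + 1 - 1 - j = nSeq n r - j by omega,
      Nat.cast_sub (show j ≤ nSeq n r by omega)]
    ring

/-- For digit `0` the partner's `y`-block occupies the positions `n_r + 1, …, 2 n_r` seen from `i`.
This segment extends both the `x`-block `0, …, n_r` and the `y`-block `1, …, n_r`. -/
theorem sum_partner_y {M : Type*} [AddCommMonoid M] {m : PortModel} (hm : m.Allows n) {r : ℕ}
    (hb : bit n r = 0) (f : Fin n → M) (i : Fin n) :
    ∑ j ∈ Finset.range (nSeq n r),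
        f (residue n (partner n r m i + direction m (partner n r m i) * ((j + 1 : ℕ) : ℤ))) =
      ∑ j ∈ Finset.range (nSeq n r),
        f (residue n (i + direction m i * ((nSeq n r + j + 1 : ℕ) : ℤ))) := by
  have h := direction_partner hm r i
  cases m with
  | twoPort =>
    refine Finset.sum_congr rfl fun j _ => ?_
    simp only at h
    rw [h, partner, residue_residue_add]
    congr 2
    push_cast [hb]; ring
  | onePort =>
    simp only at h
    rw [h, ← Finset.sum_range_reflect]
    refine Finset.sum_congr rfl fun j hj => ?_
    rw [Finset.mem_range] at hj
    rw [partner, residue_residue_add]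
    congr 2
    push_cast [show nSeq n r - 1 - j + 1 = nSeq n r - j by omega,
      Nat.cast_sub (show j ≤ nSeq n r by omega)]
    ring

end Residue

/-! ### The mixing operators -/

section Mixing

variable {n : ℕ} {V : Type*}

/-- The component of a pair of arrays that is transmitted in round `r`. -/
def transmitted (r : ℕ) (S : (Fin n → V) × (Fin n → V)) : Fin n → V :=
  if bit n r = 1 then S.1 else S.2

/-! ### Norms of arrays and of pairs of arrays -/

section ArrayNorm

variable [NormedAddCommGroup V]

/-- The Euclidean norm of an array. -/
noncomputable def arrayNorm (v : Fin n → V) : ℝ := ‖WithLp.toLp 2 v‖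

theorem arrayNorm_sq (v : Fin n → V) : arrayNorm v ^ 2 = ∑ i, ‖v i‖ ^ 2 :=
  PiLp.norm_sq_eq_of_L2 _ _

theorem arrayNorm_nonneg (v : Fin n → V) : 0 ≤ arrayNorm v := norm_nonneg _

theorem arrayNorm_comp {f : Fin n → Fin n} (hf : Function.Bijective f) (v : Fin n → V) :
    arrayNorm (fun i => v (f i)) = arrayNorm v := by
  rw [← sq_eq_sq₀ (arrayNorm_nonneg _) (arrayNorm_nonneg _), arrayNorm_sq, arrayNorm_sq]
  exact hf.sum_comp fun i => ‖v i‖ ^ 2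

/-- The norm of a pair of arrays. -/
noncomputable def pairNorm (S : (Fin n → V) × (Fin n → V)) : ℝ :=
  max (arrayNorm S.1) (arrayNorm S.2)

theorem pairNorm_add_le (S S' : (Fin n → V) × (Fin n → V)) :
    pairNorm (S + S') ≤ pairNorm S + pairNorm S' :=
  max_le ((norm_add_le (WithLp.toLp 2 S.1) (WithLp.toLp 2 S'.1)).trans
      (add_le_add (le_max_left _ _) (le_max_left _ _)))
    ((norm_add_le (WithLp.toLp 2 S.2) (WithLp.toLp 2 S'.2)).trans
      (add_le_add (le_max_right _ _) (le_max_right _ _)))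

theorem pairNorm_zero : pairNorm (0 : (Fin n → V) × (Fin n → V)) = 0 := by
  simp [pairNorm, arrayNorm]

theorem arrayNorm_transmitted_le (r : ℕ) (S : (Fin n → V) × (Fin n → V)) :
    arrayNorm (transmitted r S) ≤ pairNorm S := by
  unfold transmitted
  split_ifs
  · exact le_max_left _ _
  · exact le_max_right _ _

variable [NormedSpace ℝ V]

theorem arrayNorm_convex {a : ℝ} (h0 : 0 ≤ a) (h1 : a ≤ 1) (v w : Fin n → V) {M : ℝ}
    (hv : arrayNorm v ≤ M) (hw : arrayNorm w ≤ M) :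
    arrayNorm (fun i => a • v i + (1 - a) • w i) ≤ M := by
  have h2 : arrayNorm (fun i => a • v i + (1 - a) • w i) ≤
      a * arrayNorm v + (1 - a) * arrayNorm w := by
    have := norm_add_le (a • WithLp.toLp 2 v) ((1 - a) • WithLp.toLp 2 w)
    rw [norm_smul, norm_smul, Real.norm_of_nonneg h0,
      Real.norm_of_nonneg (sub_nonneg.2 h1)] at this
    exact this
  nlinarith [mul_le_mul_of_nonneg_left hv h0, mul_le_mul_of_nonneg_left hw (sub_nonneg.2 h1)]

theorem pairNorm_smul_diag {c : ℝ} (hc : 0 ≤ c) (v : Fin n → V) :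
    pairNorm (-(c • (v, v))) = c * arrayNorm v := by
  have : arrayNorm (-(c • v)) = c * arrayNorm v := by
    have := norm_neg (c • WithLp.toLp 2 v)
    rw [norm_smul, Real.norm_of_nonneg hc] at this
    exact this
  simp [pairNorm, this]

end ArrayNorm

variable [NeZero n]

/-- The communication part of round `r`. -/
noncomputable def mix [AddCommGroup V] [Module ℝ V] (m : PortModel) (r : ℕ)
    (S : (Fin n → V) × (Fin n → V)) : (Fin n → V) × (Fin n → V) :=
  (fun i => weightA n r • S.1 i + (1 - weightA n r) • transmitted r S (partner n r m i),
    fun i => weightB n r • S.2 i + (1 - weightB n r) • transmitted r S (partner n r m i))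

/-- The evolution of a pair of arrays under communication only, starting with round `0`. -/
noncomputable def evolve [AddCommGroup V] [Module ℝ V] (m : PortModel)
    (S : (Fin n → V) × (Fin n → V)) : ℕ → (Fin n → V) × (Fin n → V)
  | 0 => S
  | j + 1 => mix m (j % tau n) (evolve m S j)

/-! ### Exact consensus after one cycle of communication -/

section Algebra

variable [AddCommGroup V] [Module ℝ V]

theorem mix_sub (m : PortModel) (r : ℕ) (S S' : (Fin n → V) × (Fin n → V)) :
    mix m r (S - S') = mix m r S - mix m r S' := by
  unfold mix transmitted
  ext i <;> split_ifs <;> simp <;> module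

theorem mix_zero (m : PortModel) (r : ℕ) : mix (n := n) (V := V) m r 0 = 0 := by
  have := mix_sub (n := n) (V := V) m r 0 0
  simpa using this

theorem mix_const (m : PortModel) (r : ℕ) (v : V) :
    mix (n := n) m r (fun _ => v, fun _ => v) = (fun _ => v, fun _ => v) := by
  unfold mix transmitted
  ext i <;> split_ifs <;> simp

theorem weightA_bounds (n r : ℕ) : 0 ≤ weightA n r ∧ weightA n r ≤ 1 := by
  unfold weightA
  split_ifs
  · norm_num
  · exact ⟨by positivity, by rw [div_le_one (by positivity)]; linarith [Nat.cast_nonneg (α := ℝ) (nSeq n r)]⟩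

theorem weightB_bounds (n r : ℕ) : 0 ≤ weightB n r ∧ weightB n r ≤ 1 := by
  unfold weightB
  split_ifs
  · exact ⟨by positivity, by rw [div_le_one (by positivity)]; linarith [Nat.cast_nonneg (α := ℝ) (nSeq n r)]⟩
  · norm_num

/-- The weights are the relative lengths of the two glued blocks, so means of blocks become means of
their union. Multiplying by the lengths makes the empty `y`-block at `r = 0` harmless; therefore
`S.2` never enters. -/
theorem evolve_eq_sum {m : PortModel} (hm : m.Allows n) (S : (Fin n → V) × (Fin n → V)) {r : ℕ}
    (hr : r ≤ tau n) :
    (∀ i, ((nSeq n r : ℝ) + 1) • (evolve m S r).1 i =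
      ∑ j ∈ Finset.range (nSeq n r + 1), S.1 (residue n (i + direction m i * (j : ℕ)))) ∧
    (∀ i, (nSeq n r : ℝ) • (evolve m S r).2 i =
      ∑ j ∈ Finset.range (nSeq n r),
        S.1 (residue n (i + direction m i * ((j + 1 : ℕ) : ℤ)))) := by
  induction r with
  | zero => simp [nSeq, evolve, residue_coe]
  | succ r ih =>
    obtain ⟨hx, hy⟩ := ih (by omega)
    have hmod : r % tau n = r := Nat.mod_eq_of_lt (by omega)
    have hN : (0 : ℝ) ≤ nSeq n r := Nat.cast_nonneg _
    by_cases hb : bit n r = 1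
    · have hs : nSeq n (r + 1) = (nSeq n r + 1) + nSeq n r := by rw [nSeq, hb]; omega
      have hs' : nSeq n (r + 1) = nSeq n r + (nSeq n r + 1) := by rw [nSeq, hb]; omega
      refine ⟨fun i => ?_, fun i => ?_⟩
      · rw [show nSeq n (r + 1) + 1 = (nSeq n r + 1) + (nSeq n r + 1) by omega,
          Finset.sum_range_add, ← sum_partner_x hm hb, ← hx, ← hx, hs]
        simp only [evolve, hmod, mix, transmitted, weightA, hb, if_true]
        push_cast
        module
      · rw [hs', Finset.sum_range_add, ← hy]
        have h1 := sum_partner_x hm hb S.1 i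
        rw [← hx] at h1
        simp only [add_right_comm _ 1 _] at h1
        simp only [add_assoc] at h1 ⊢
        rw [← h1]
        simp only [evolve, hmod, mix, transmitted, weightB, hb, if_true]
        push_cast
        rw [smul_add, smul_smul, smul_smul]
        congr 2 <;> field_simp <;> ring
    · have hb0 := bit_eq_zero_of_ne_one hb
      have hs : nSeq n (r + 1) = nSeq n r + nSeq n r := by rw [nSeq, hb0]; omega
      refine ⟨fun i => ?_, fun i => ?_⟩
      · rw [show nSeq n (r + 1) + 1 = (nSeq n r + 1) + nSeq n r by omega,
          Finset.sum_range_add, ← hx]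
        have h1 := sum_partner_y hm hb0 S.1 i
        rw [← hy] at h1
        simp only [add_right_comm _ _ 1] at h1
        rw [← h1, hs]
        simp only [evolve, hmod, mix, transmitted, weightA, hb, if_false]
        push_cast
        rw [smul_add, smul_smul, smul_smul]
        congr 2 <;> field_simp <;> ring
      · rw [hs, Finset.sum_range_add, ← sum_partner_y hm hb0, ← hy, ← hy]
        simp only [evolve, hmod, mix, transmitted, weightB, hb, if_false]
        push_cast
        module

/-- After one cycle `x` is the global mean, here zero, whereas `y` still averages only `n - 1`
agents and need not vanish. The following round `0` transmits `x` and gives the old `y` weight zero,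
so both arrays vanish afterwards. This is why the transmitted array, not the pair, is controlled
from time `τ` on. -/
theorem transmitted_evolve_eq_zero (hn : 2 ≤ n) {m : PortModel} (hm : m.Allows n)
    (S : (Fin n → V) × (Fin n → V)) (hS : ∑ i, S.1 i = 0) {j : ℕ} (hj : tau n ≤ j) :
    transmitted (j % tau n) (evolve m S j) = 0 := by
  have h1 : (evolve m S (tau n)).1 = 0 := by
    ext i
    have h := (evolve_eq_sum hm S le_rfl).1 i
    rw [nSeq_tau hn, Nat.sub_add_cancel (by omega),
      sum_range_residue S.1 i _ (direction_eq m i), hS] at h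
    refine (smul_eq_zero.1 h).resolve_left ?_
    positivity
  have h2 : ∀ l, evolve m S (tau n + 1 + l) = 0 := by
    intro l
    induction l with
    | zero =>
      have hw : weightB n 0 = 0 := by simp [weightB, bit_zero hn, nSeq]
      simp only [evolve, Nat.mod_self, mix, transmitted, bit_zero hn, if_true, h1, hw]
      ext i <;> simp
    | succ l ih => rw [← add_assoc, evolve, ih, mix_zero]
  rcases hj.eq_or_lt with rfl | hlt
  · simp [transmitted, bit_zero hn, h1]
  · obtain ⟨l, rfl⟩ := Nat.exists_eq_add_of_le (show tau n + 1 ≤ j from hlt)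
    rw [h2]
    simp [transmitted]

end Algebra

/-! ### Nonexpansiveness and finite memory -/

section Norm

variable [NormedAddCommGroup V] [NormedSpace ℝ V]

/-- Receiving from partners permutes the entries, and the weights are convex. The maximum of the two
norms is used because part of either array is replaced by entries of the same transmitted array. -/
theorem pairNorm_mix_le {m : PortModel} (hm : m.Allows n) (r : ℕ)
    (S : (Fin n → V) × (Fin n → V)) : pairNorm (mix m r S) ≤ pairNorm S := by
  have h : arrayNorm (fun i => transmitted r S (partner n r m i)) ≤ pairNorm S := by
    rw [arrayNorm_comp (partner_bijective hm r)]
    exact arrayNorm_transmitted_le r S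
  exact max_le
    (arrayNorm_convex (weightA_bounds n r).1 (weightA_bounds n r).2 _ _ (le_max_left _ _) h)
    (arrayNorm_convex (weightB_bounds n r).1 (weightB_bounds n r).2 _ _ (le_max_right _ _) h)

/-- Deviations from consensus are caused by the gradients of the last `2 τ` iterations only. -/
theorem arrayNorm_transmitted_le_sum (hn : 2 ≤ n) {m : PortModel} (hm : m.Allows n) {γ : ℝ}
    (hγ : 0 ≤ γ) {X : ℕ → (Fin n → V) × (Fin n → V)} {h : ℕ → Fin n → V} {s : ℕ} (hs : s ≤ tau n)
    (h0 : X 0 = 0) (havg : ∀ k < s, X (k + 1) = 0)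
    (hmix : ∀ k, s ≤ k → X (k + 1) = mix m (k % tau n) (X k - γ • (h k, h k)))
    (hsum : ∀ k, ∑ i, (X k).1 i = 0) (k : ℕ) :
    arrayNorm (transmitted (k % tau n) (X k)) ≤
      γ * ∑ l ∈ Finset.Ico (k - 2 * tau n) k, arrayNorm (h l) := by
  have hτ := tau_pos hn
  by_cases hk : k < 2 * tau n
  -- In the first two cycles nothing has to be forgotten: `X 0 = 0` and nonexpansiveness suffice.
  · have key : ∀ k, pairNorm (X k) ≤ γ * ∑ l ∈ Finset.range k, arrayNorm (h l) := by
      intro k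
      induction k with
      | zero => simp [h0, pairNorm_zero]
      | succ k ih =>
        rcases lt_or_ge k s with hks | hks
        · rw [havg k hks, pairNorm_zero]
          exact mul_nonneg hγ (Finset.sum_nonneg fun _ _ => arrayNorm_nonneg _)
        · rw [hmix k hks, Finset.sum_range_succ, mul_add, sub_eq_add_neg]
          refine (pairNorm_mix_le hm _ _).trans ((pairNorm_add_le _ _).trans ?_)
          rw [pairNorm_smul_diag hγ]
          linarith
    rw [Nat.sub_eq_zero_of_le hk.le, ← Finset.range_eq_Ico]
    exact (arrayNorm_transmitted_le _ _).trans (key k)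
  · obtain ⟨q, hq⟩ : ∃ q, k / tau n = q + 2 :=
      Nat.exists_eq_add_of_le' ((Nat.le_div_iff_mul_le hτ).2 (by omega))
    have hdiv := Nat.div_add_mod k (tau n)
    have hlt := Nat.mod_lt k hτ
    rw [hq] at hdiv
    -- The restart time. As a multiple of `τ` it aligns the rounds with those of `evolve`; it
    -- satisfies `τ ≤ k - t < 2τ`, and `s ≤ t` leaves no averaging step after it.
    set t := tau n * (q + 1) with ht
    obtain ⟨j, hj⟩ : ∃ j, k = t + j := ⟨tau n + k % tau n, by rw [ht]; linarith⟩
    have hjτ : tau n ≤ j := by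
      have : tau n * (q + 2) = t + tau n := by rw [ht]; ring
      omega
    have hkt : k - 2 * tau n ≤ t := by
      have : tau n * (q + 2) = t + tau n := by rw [ht]; ring
      omega
    have hst : s ≤ t := hs.trans (by rw [ht]; exact Nat.le_mul_of_pos_right _ (by omega))
    have hmod : ∀ j, (t + j) % tau n = j % tau n := fun j => by rw [ht, Nat.mul_add_mod]
    -- By linearity, the difference from pure communication is driven only by the gradients after
    -- `t`.
    have key : ∀ j, pairNorm (X (t + j) - evolve m (X t) j) ≤
        γ * ∑ l ∈ Finset.Ico t (t + j), arrayNorm (h l) := by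
      intro j
      induction j with
      | zero => simp [evolve, pairNorm_zero]
      | succ j ih =>
        rw [← add_assoc, hmix _ (by omega), hmod, evolve, ← mix_sub,
          Finset.sum_Ico_succ_top (by omega), mul_add]
        refine (pairNorm_mix_le hm _ _).trans ?_
        rw [sub_right_comm, sub_eq_add_neg]
        refine (pairNorm_add_le _ _).trans ?_
        rw [pairNorm_smul_diag hγ]
        linarith
    have h1 : transmitted (k % tau n) (X k) =
        transmitted (k % tau n) (X k - evolve m (X t) j) := by
      have h2 := transmitted_evolve_eq_zero hn hm (X t) (hsum t) hjτ
      rw [← hmod, ← hj] at h2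
      unfold transmitted at h2 ⊢
      split_ifs at h2 ⊢ <;> simp [h2]
    rw [h1]
    refine (arrayNorm_transmitted_le _ _).trans ?_
    have h3 := key j
    rw [← hj] at h3
    refine h3.trans (mul_le_mul_of_nonneg_left ?_ hγ)
    exact Finset.sum_le_sum_of_subset_of_nonneg (Finset.Ico_subset_Ico_left hkt)
      fun _ _ _ => arrayNorm_nonneg _

/-- Cauchy–Schwarz over a window of at most `2τ` iterations produces the factor `2τ`. -/
theorem sum_norm_sq_transmitted_le (hn : 2 ≤ n) {m : PortModel} (hm : m.Allows n) {γ : ℝ}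
    (hγ : 0 ≤ γ) {X : ℕ → (Fin n → V) × (Fin n → V)} {h : ℕ → Fin n → V} {s : ℕ} (hs : s ≤ tau n)
    (h0 : X 0 = 0) (havg : ∀ k < s, X (k + 1) = 0)
    (hmix : ∀ k, s ≤ k → X (k + 1) = mix m (k % tau n) (X k - γ • (h k, h k)))
    (hsum : ∀ k, ∑ i, (X k).1 i = 0) (k : ℕ) :
    ∑ i, ‖transmitted (k % tau n) (X k) i‖ ^ 2 ≤
      2 * γ ^ 2 * tau n * ∑ l ∈ Finset.Ico (k - 2 * tau n) k, ∑ i, ‖h l i‖ ^ 2 := by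
  have h1 := arrayNorm_transmitted_le_sum hn hm hγ hs h0 havg hmix hsum k
  have h2 := pow_le_pow_left₀ (arrayNorm_nonneg _) h1 2
  have h3 := sq_sum_le_card_mul_sum_sq (s := Finset.Ico (k - 2 * tau n) k)
    (f := fun l => arrayNorm (h l))
  rw [arrayNorm_sq, mul_pow] at h2
  simp only [arrayNorm_sq, Nat.card_Ico] at h3
  have h4 : ((k - (k - 2 * tau n) : ℕ) : ℝ) ≤ 2 * tau n := by
    exact_mod_cast (by omega : k - (k - 2 * tau n) ≤ 2 * tau n)
  refine h2.trans ((mul_le_mul_of_nonneg_left (h3.trans (mul_le_mul_of_nonneg_right h4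
    (by positivity))) (sq_nonneg γ)).trans (le_of_eq ?_))
  ring

end Norm

end Mixing

/-! ### Smooth functions -/

section Smooth

variable {E : Type*} [NormedAddCommGroup E] [InnerProductSpace ℝ E] [CompleteSpace E]

theorem le_add_inner_gradient {f : E → ℝ} {L : ℝ} (hf : Differentiable ℝ f)
    (hL : ∀ x y, ‖gradient f x - gradient f y‖ ≤ L * ‖x - y‖) (x v : E) :
    f (x + v) ≤ f x + inner ℝ (gradient f x) v + L / 2 * ‖v‖ ^ 2 := by
  -- The excess of `f` over its quadratic upper model along the segment, up to a constant; the
  -- Lipschitz gradient makes it nonincreasing.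
  let φ : ℝ → ℝ := fun t => f (x + t • v) - t * inner ℝ (gradient f x) v - L / 2 * ‖v‖ ^ 2 * t ^ 2
  have hφ : ∀ t, HasDerivAt φ
      (inner ℝ (gradient f (x + t • v)) v - inner ℝ (gradient f x) v - L * ‖v‖ ^ 2 * t) t := by
    intro t
    have h1 : HasDerivAt (fun t : ℝ => x + t • v) v t := by
      simpa using ((hasDerivAt_id t).smul_const v).const_add x
    have h2 := (hf (x + t • v)).hasGradientAt.hasFDerivAt.comp_hasDerivAt t h1
    rw [InnerProductSpace.toDual_apply_apply] at h2
    have h3 := (h2.sub ((hasDerivAt_id t).mul_const (inner ℝ (gradient f x) v))).sub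
      ((hasDerivAt_pow 2 t).const_mul (L / 2 * ‖v‖ ^ 2))
    refine h3.congr_deriv ?_
    norm_num
    ring
  have hanti : AntitoneOn φ (Set.Icc 0 1) := by
    refine antitoneOn_of_deriv_nonpos (convex_Icc 0 1)
      (fun t _ => (hφ t).continuousAt.continuousWithinAt)
      (fun t _ => (hφ t).differentiableAt.differentiableWithinAt) fun t ht => ?_
    rw [interior_Icc] at ht
    rw [(hφ t).deriv, ← inner_sub_left]
    have h1 := real_inner_le_norm (gradient f (x + t • v) - gradient f x) v
    have h2 := hL (x + t • v) x
    rw [add_sub_cancel_left, norm_smul, Real.norm_of_nonneg ht.1.le] at h2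
    nlinarith [mul_le_mul_of_nonneg_right h2 (norm_nonneg v)]
  have h := hanti (Set.left_mem_Icc.2 zero_le_one) (Set.right_mem_Icc.2 zero_le_one) zero_le_one
  simp only [φ, one_smul, zero_smul, add_zero] at h
  linarith

/-- A gradient step of size `1 / L` lowers `f` by at least `‖∇f‖² / (2L)`, yet not below `c`. This
turns integrability of the objective into square integrability of its gradient. -/
theorem norm_gradient_sq_le {f : E → ℝ} {L c : ℝ} (hL0 : 0 < L) (hf : Differentiable ℝ f)
    (hL : ∀ x y, ‖gradient f x - gradient f y‖ ≤ L * ‖x - y‖) (hc : ∀ x, c ≤ f x) (x : E) :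
    ‖gradient f x‖ ^ 2 ≤ 2 * L * (f x - c) := by
  have h := le_add_inner_gradient hf hL x (-(1 / L) • gradient f x)
  have h2 := hc (x + -(1 / L) • gradient f x)
  rw [inner_smul_right, real_inner_self_eq_norm_sq, norm_smul, mul_pow, Real.norm_eq_abs,
    sq_abs] at h
  have h3 : L / 2 * ((-(1 / L)) ^ 2 * ‖gradient f x‖ ^ 2) = 1 / (2 * L) * ‖gradient f x‖ ^ 2 := by
    field_simp
  have h4 : 1 / L * ‖gradient f x‖ ^ 2 = 2 * (1 / (2 * L) * ‖gradient f x‖ ^ 2) := by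
    field_simp
  have h5 : 1 / (2 * L) * ‖gradient f x‖ ^ 2 ≤ f x - c := by linarith
  rw [one_div_mul_eq_div, div_le_iff₀ (by positivity)] at h5
  linarith

end Smooth

/-! ### Averages -/

section Mean

variable {n d : ℕ}

theorem mean_add (v w : Fin n → Vec d) : mean (fun i => v i + w i) = mean v + mean w := by
  simp [mean, Finset.sum_add_distrib]

theorem mean_sub (v w : Fin n → Vec d) : mean (fun i => v i - w i) = mean v - mean w := by
  simp [mean, Finset.sum_sub_distrib, smul_sub]

theorem mean_smul (c : ℝ) (v : Fin n → Vec d) : mean (fun i => c • v i) = c • mean v := by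
  simp only [mean, ← Finset.smul_sum, smul_comm c]

theorem mean_const (hn : 0 < n) (v : Vec d) : mean (fun _ : Fin n => v) = v := by
  have : (n : ℝ) ≠ 0 := by positivity
  simp [mean, ← Nat.cast_smul_eq_nsmul ℝ, smul_smul, this]

theorem sum_sub_mean (hn : 0 < n) (v : Fin n → Vec d) : ∑ i, (v i - mean v) = 0 := by
  have : (n : ℝ) ≠ 0 := by positivity
  simp [mean, ← Nat.cast_smul_eq_nsmul ℝ, smul_smul, this]

theorem norm_mean_sq_le (hn : 0 < n) (v : Fin n → Vec d) :
    ‖mean v‖ ^ 2 ≤ (1 / (n : ℝ)) * ∑ i, ‖v i‖ ^ 2 := by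
  have hn' : (0 : ℝ) < n := by positivity
  rw [mean, norm_smul, mul_pow, Real.norm_of_nonneg (by positivity)]
  have h1 : ‖∑ i, v i‖ ^ 2 ≤ n * ∑ i, ‖v i‖ ^ 2 := by
    refine (pow_le_pow_left₀ (norm_nonneg _) (norm_sum_le _ _) 2).trans ?_
    simpa using sq_sum_le_card_mul_sum_sq (s := Finset.univ) (f := fun i => ‖v i‖)
  calc (1 / (n : ℝ)) ^ 2 * ‖∑ i, v i‖ ^ 2 ≤ (1 / (n : ℝ)) ^ 2 * (n * ∑ i, ‖v i‖ ^ 2) := by gcongr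
    _ = _ := by field_simp

theorem sum_norm_sub_mean_sq_le (hn : 0 < n) (v : Fin n → Vec d) (c : Vec d) :
    ∑ i, ‖v i - mean v‖ ^ 2 ≤ ∑ i, ‖v i - c‖ ^ 2 := by
  have h : ∀ i, ‖v i - c‖ ^ 2 =
      ‖v i - mean v‖ ^ 2 + 2 * inner ℝ (v i - mean v) (mean v - c) + ‖mean v - c‖ ^ 2 := by
    intro i
    rw [← norm_add_sq_real, sub_add_sub_cancel]
  simp only [h, Finset.sum_add_distrib, ← Finset.mul_sum, ← sum_inner, sum_sub_mean hn,
    inner_zero_left]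
  have : 0 ≤ ∑ _i : Fin n, ‖mean v - c‖ ^ 2 := by positivity
  linarith

theorem norm_add_three_sq_le {E : Type*} [NormedAddCommGroup E] (u v w : E) :
    ‖u + v + w‖ ^ 2 ≤ 3 * (‖u‖ ^ 2 + ‖v‖ ^ 2 + ‖w‖ ^ 2) := by
  have h := pow_le_pow_left₀ (norm_nonneg _) (norm_add₃_le (a := u) (b := v) (c := w)) 2
  nlinarith [sq_nonneg (‖u‖ - ‖v‖), sq_nonneg (‖u‖ - ‖w‖), sq_nonneg (‖v‖ - ‖w‖)]

theorem measurable_mean {Ω : Type*} {_ : MeasurableSpace Ω} {v : Fin n → Ω → Vec d}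
    (hv : ∀ i, Measurable (v i)) : Measurable (fun ω => mean (fun i => v i ω)) :=
  (Finset.measurable_fun_sum Finset.univ fun i _ => hv i).const_smul (1 / (n : ℝ))

theorem memLp_mean {Ω : Type*} [MeasurableSpace Ω] {P : Measure Ω} {v : Fin n → Ω → Vec d}
    (hv : ∀ i, MemLp (v i) 2 P) : MemLp (fun ω => mean (fun i => v i ω)) 2 P :=
  (memLp_finsetSum Finset.univ fun i _ => hv i).const_smul (1 / (n : ℝ))

end Mean

/-! ### The objective -/

namespace Problem

variable {n d : ℕ} {Ξ : Type*} [MeasurableSpace Ξ] {p : Problem n d Ξ} {L b : ℝ}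

theorem LipschitzSmooth.hasGradientAt_obj (h : p.LipschitzSmooth L) (x : Vec d) :
    HasGradientAt p.obj (mean fun i => gradient (p.localObj i) x) x := by
  have h1 : HasFDerivAt p.obj ((1 / (n : ℝ)) • ∑ i, fderiv ℝ (p.localObj i) x) x :=
    (HasFDerivAt.fun_sum fun i _ => (h.differentiable i x).hasFDerivAt).const_mul (1 / (n : ℝ))
  rw [hasGradientAt_iff_hasFDerivAt]
  refine h1.congr_fderiv ?_
  simp [mean, gradient]

theorem LipschitzSmooth.differentiable_obj (h : p.LipschitzSmooth L) : Differentiable ℝ p.obj :=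
  fun x => (h.hasGradientAt_obj x).differentiableAt

theorem LipschitzSmooth.gradient_obj (h : p.LipschitzSmooth L) (x : Vec d) :
    gradient p.obj x = mean fun i => gradient (p.localObj i) x :=
  (h.hasGradientAt_obj x).gradient

theorem LipschitzSmooth.lipschitz_obj (h : p.LipschitzSmooth L) (hn : 0 < n) (x y : Vec d) :
    ‖gradient p.obj x - gradient p.obj y‖ ≤ L * ‖x - y‖ := by
  have hn' : (0 : ℝ) < n := by positivity
  rw [h.gradient_obj, h.gradient_obj, ← mean_sub, mean, norm_smul,
    Real.norm_of_nonneg (by positivity)]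
  have h1 : ‖∑ i, (gradient (p.localObj i) x - gradient (p.localObj i) y)‖ ≤
      n * (L * ‖x - y‖) := by
    simpa using norm_sum_le_of_le Finset.univ fun i _ => h.lipschitz i x y
  calc 1 / (n : ℝ) * _ ≤ 1 / (n : ℝ) * (n * (L * ‖x - y‖)) := by gcongr
    _ = _ := by field_simp

theorem continuous_of_norm_sub_le {g : Vec d → Vec d}
    (h : ∀ x y, ‖g x - g y‖ ≤ L * ‖x - y‖) : Continuous g :=
  (LipschitzWith.of_dist_le_mul (K := L.toNNReal) fun x y => by
    rw [dist_eq_norm, dist_eq_norm]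
    exact (h x y).trans (by gcongr; exact Real.le_coe_toNNReal L)).continuous

theorem LipschitzSmooth.measurable_gradient (h : p.LipschitzSmooth L) (i : Fin n) :
    Measurable (gradient (p.localObj i)) :=
  (continuous_of_norm_sub_le (h.lipschitz i)).measurable

theorem LipschitzSmooth.measurable_gradient_obj (h : p.LipschitzSmooth L) (hn : 0 < n) :
    Measurable (gradient p.obj) :=
  (continuous_of_norm_sub_le (h.lipschitz_obj hn)).measurable

theorem WellPosed.fStar_le (h : p.WellPosed) (x : Vec d) : p.fStar ≤ p.obj x :=
  ciInf_le h.bddBelow x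

end Problem

/-! ### One stochastic gradient step at nearly equal points -/

section Step

variable {n d : ℕ} {Ξ Ω : Type*} [MeasurableSpace Ξ] [MeasurableSpace Ω] {P : Measure Ω}
  {p : Problem n d Ξ} {L σ b γ : ℝ}

theorem memLp_gradient_sub (hs : p.LipschitzSmooth L) {x z : Ω → Vec d} (hx : Measurable x)
    (hz : Measurable z) (hzx : MemLp (fun ω => z ω - x ω) 2 P) (i : Fin n) :
    MemLp (fun ω => gradient (p.localObj i) (z ω) - gradient (p.localObj i) (x ω)) 2 P :=
  hzx.of_le_mul (c := L) (((hs.measurable_gradient i).comp hz).sub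
    ((hs.measurable_gradient i).comp hx)).aestronglyMeasurable
    (Filter.Eventually.of_forall fun ω => hs.lipschitz i (z ω) (x ω))

theorem integrable_inner {u v : Ω → Vec d} (hu : MemLp u 2 P) (hv : MemLp v 2 P) :
    Integrable (fun ω => inner ℝ (u ω) (v ω)) P :=
  (hu.norm.integrable_mul hv.norm).mono' (hu.1.inner hv.1)
    (Filter.Eventually.of_forall fun ω => norm_inner_le_norm (u ω) (v ω))

theorem integral_inner_mean {u : Ω → Vec d} {v : Fin n → Ω → Vec d} (hu : MemLp u 2 P)
    (hv : ∀ i, MemLp (v i) 2 P) :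
    ∫ ω, inner ℝ (u ω) (mean fun i => v i ω) ∂P =
      1 / (n : ℝ) * ∑ i, ∫ ω, inner ℝ (u ω) (v i ω) ∂P := by
  simp only [mean, inner_smul_right, inner_sum]
  rw [integral_const_mul, integral_finsetSum _ fun i _ => integrable_inner hu (hv i)]

/-- Cross terms vanish, so averaging divides the variance bound by `n`: the source of the linear
speedup. -/
theorem integral_norm_mean_sq_le (hn : 0 < n) {v : Fin n → Ω → Vec d}
    (hv : ∀ i, MemLp (v i) 2 P) (hvar : ∀ i, ∫ ω, ‖v i ω‖ ^ 2 ∂P ≤ σ ^ 2)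
    (horth : ∀ i j, i ≠ j → ∫ ω, inner ℝ (v i ω) (v j ω) ∂P = 0) :
    ∫ ω, ‖mean fun i => v i ω‖ ^ 2 ∂P ≤ σ ^ 2 / n := by
  have hn' : (0 : ℝ) < n := by positivity
  have h1 : ∀ i, ∫ ω, inner ℝ (mean fun j => v j ω) (v i ω) ∂P ≤ 1 / (n : ℝ) * σ ^ 2 := by
    intro i
    simp only [real_inner_comm (v i _)]
    rw [integral_inner_mean (hv i) hv, Finset.sum_eq_single i (fun j _ hj => horth i j hj.symm)
      (by simp)]
    simp only [real_inner_self_eq_norm_sq]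
    gcongr
    exact hvar i
  simp only [← real_inner_self_eq_norm_sq]
  rw [integral_inner_mean (memLp_mean hv) hv]
  calc _ ≤ 1 / (n : ℝ) * ∑ _i : Fin n, 1 / (n : ℝ) * σ ^ 2 := by gcongr with i; exact h1 i
    _ = σ ^ 2 / n := by simp; field_simp

variable [IsProbabilityMeasure P]

theorem memLp_gradient_obj (hL : 0 < L) (hn : 0 < n) (hp : p.WellPosed) (hs : p.LipschitzSmooth L)
    {x : Ω → Vec d} (hx : Measurable x) (hint : Integrable (fun ω => p.obj (x ω)) P) :
    MemLp (fun ω => gradient p.obj (x ω)) 2 P := by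
  have hm : Measurable fun ω => gradient p.obj (x ω) := (hs.measurable_gradient_obj hn).comp hx
  rw [memLp_two_iff_integrable_sq_norm hm.aestronglyMeasurable]
  refine ((hint.sub (integrable_const p.fStar)).const_mul (2 * L)).mono'
    (hm.norm.pow_const 2).aestronglyMeasurable (Filter.Eventually.of_forall fun ω => ?_)
  rw [Real.norm_of_nonneg (by positivity)]
  exact norm_gradient_sq_le hL hs.differentiable_obj (hs.lipschitz_obj hn) hp.fStar_le (x ω)

theorem memLp_gradient_sub_obj (hn : 0 < n) (hs : p.LipschitzSmooth L)
    (hb : p.DataHeterogeneity b) {x : Ω → Vec d} (hx : Measurable x) (i : Fin n) :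
    MemLp (fun ω => gradient (p.localObj i) (x ω) - gradient p.obj (x ω)) 2 P := by
  refine MemLp.of_bound (((hs.measurable_gradient i).comp hx).sub
    ((hs.measurable_gradient_obj hn).comp hx)).aestronglyMeasurable (√(n * b ^ 2))
    (Filter.Eventually.of_forall fun ω => Real.le_sqrt_of_sq_le ?_)
  have hn' : (0 : ℝ) < n := by positivity
  have h := hb (x ω)
  rw [one_div_mul_eq_div, div_le_iff₀ hn', mul_comm] at h
  exact (Finset.single_le_sum (f := fun i => ‖gradient (p.localObj i) (x ω) -
    gradient p.obj (x ω)‖ ^ 2) (fun _ _ => by positivity) (Finset.mem_univ i)).trans h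

/-- Polarization writes `-⟨A, G⟩` as `(‖A - G‖² - ‖A‖² - ‖G‖²) / 2`, and `L γ ≤ 1` absorbs the term
in `‖G‖²`. The terms linear in the noise stay separate, to vanish in expectation. -/
theorem obj_step_le (hn : 0 < n) (hs : p.LipschitzSmooth L) (hγ : 0 ≤ γ)
    (hLγ : L * γ ≤ 1) (x v : Vec d) (z : Fin n → Vec d) :
    p.obj (x - γ • (mean (fun i => gradient (p.localObj i) (z i)) + v)) ≤
      p.obj x - γ / 2 * ‖gradient p.obj x‖ ^ 2
        + γ / 2 * (L ^ 2 * (1 / (n : ℝ) * ∑ i, ‖z i - x‖ ^ 2))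
        - γ * inner ℝ (gradient p.obj x) v
        + L * γ ^ 2 * inner ℝ (mean fun i => gradient (p.localObj i) (z i)) v
        + L * γ ^ 2 / 2 * ‖v‖ ^ 2 := by
  set A := gradient p.obj x with hA
  set G := mean fun i => gradient (p.localObj i) (z i) with hG
  have hn' : (0 : ℝ) < n := by positivity
  have h1 := le_add_inner_gradient hs.differentiable_obj (hs.lipschitz_obj hn) x (-(γ • (G + v)))
  have h2 : ‖A - G‖ ^ 2 ≤ L ^ 2 * (1 / (n : ℝ) * ∑ i, ‖z i - x‖ ^ 2) := by
    rw [hA, hG, hs.gradient_obj, ← mean_sub]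
    refine (norm_mean_sq_le hn _).trans ?_
    rw [mul_left_comm, Finset.mul_sum _ _ (L ^ 2)]
    refine mul_le_mul_of_nonneg_left (Finset.sum_le_sum fun i _ => ?_) (by positivity : (0 : ℝ) ≤ 1 / n)
    rw [← mul_pow, norm_sub_rev (z i)]
    exact pow_le_pow_left₀ (norm_nonneg _) (hs.lipschitz i x (z i)) 2
  rw [← sub_eq_add_neg, norm_neg, norm_smul, mul_pow, Real.norm_of_nonneg hγ, norm_add_sq_real,
    inner_neg_right, inner_smul_right, inner_add_right, ← hA] at h1
  rw [norm_sub_sq_real] at h2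
  nlinarith [mul_le_mul_of_nonneg_left h2 hγ,
    mul_nonneg (mul_nonneg hγ (sub_nonneg.2 hLγ)) (sq_nonneg ‖G‖)]

theorem integral_obj_step_le (hL : 0 < L) (hn : 0 < n) (hp : p.WellPosed)
    (hs : p.LipschitzSmooth L) (hγ : 0 ≤ γ) (hLγ : L * γ ≤ 1) {x : Ω → Vec d}
    {z v : Fin n → Ω → Vec d} (hx : Measurable x) (hz : ∀ i, Measurable (z i))
    (hint : Integrable (fun ω => p.obj (x ω)) P) (hzx : ∀ i, MemLp (fun ω => z i ω - x ω) 2 P)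
    (hv : ∀ i, MemLp (v i) 2 P) (hvar : ∀ i, ∫ ω, ‖v i ω‖ ^ 2 ∂P ≤ σ ^ 2)
    (horth : ∀ i j, i ≠ j → ∫ ω, inner ℝ (v i ω) (v j ω) ∂P = 0)
    (horth₁ : ∀ i, MemLp (fun ω => gradient p.obj (x ω)) 2 P →
      ∫ ω, inner ℝ (gradient p.obj (x ω)) (v i ω) ∂P = 0)
    (horth₂ : ∀ i, MemLp (fun ω => mean fun j => gradient (p.localObj j) (z j ω)) 2 P →
      ∫ ω, inner ℝ (mean fun j => gradient (p.localObj j) (z j ω)) (v i ω) ∂P = 0) :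
    Integrable (fun ω => p.obj (x ω - γ • mean fun i => gradient (p.localObj i) (z i ω) + v i ω)) P
    ∧ ∫ ω, p.obj (x ω - γ • mean fun i => gradient (p.localObj i) (z i ω) + v i ω) ∂P ≤
      ∫ ω, p.obj (x ω) ∂P - γ / 2 * ∫ ω, ‖gradient p.obj (x ω)‖ ^ 2 ∂P
        + γ / 2 * (L ^ 2 * (1 / (n : ℝ) * ∑ i, ∫ ω, ‖z i ω - x ω‖ ^ 2 ∂P))
        + L * γ ^ 2 / 2 * (σ ^ 2 / n) := by
  have hA := memLp_gradient_obj hL hn hp hs hx hint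
  have hG : MemLp (fun ω => mean fun j => gradient (p.localObj j) (z j ω)) 2 P := by
    have h := hA.add (memLp_mean fun i => memLp_gradient_sub hs hx (hz i) (hzx i) i)
    refine h.congr_norm ?_ (Filter.Eventually.of_forall fun ω => ?_)
    · exact (measurable_mean fun i =>
        (hs.measurable_gradient i).comp (hz i)).aestronglyMeasurable
    · simp [mean_sub, hs.gradient_obj]
  have hvm := memLp_mean hv
  have I1 := integrable_inner hA hvm
  have I2 := integrable_inner hG hvm
  have I3 := hvm.norm.integrable_sq
  have I4 := hA.norm.integrable_sq
  have I5 : Integrable (fun ω => ∑ i, ‖z i ω - x ω‖ ^ 2) P :=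
    integrable_finsetSum _ fun i _ => (hzx i).norm.integrable_sq
  have Z1 : ∫ ω, inner ℝ (gradient p.obj (x ω)) (mean fun i => v i ω) ∂P = 0 := by
    rw [integral_inner_mean hA hv, Finset.sum_eq_zero fun i _ => horth₁ i hA, mul_zero]
  have Z2 : ∫ ω, inner ℝ (mean fun j => gradient (p.localObj j) (z j ω))
      (mean fun i => v i ω) ∂P = 0 := by
    rw [integral_inner_mean hG hv, Finset.sum_eq_zero fun i _ => horth₂ i hG, mul_zero]
  have Z3 := integral_norm_mean_sq_le hn hv hvar horth
  simp only [mean_add]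
  have hle := fun ω => obj_step_le hn hs hγ hLγ (x ω) (mean fun i => v i ω) (fun i => z i ω)
  have J1 := hint.sub (I4.const_mul (γ / 2))
  have J2 := J1.add (((I5.const_mul (1 / (n : ℝ))).const_mul (L ^ 2)).const_mul (γ / 2))
  have J3 := J2.sub (I1.const_mul γ)
  have J4 := J3.add (I2.const_mul (L * γ ^ 2))
  have J5 := J4.add (I3.const_mul (L * γ ^ 2 / 2))
  have hmeas := hs.differentiable_obj.continuous.comp_aestronglyMeasurable
    (hx.aestronglyMeasurable.sub ((hG.1.add hvm.1).const_smul γ))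
  -- The new objective value lies between `f⋆` and the integrable right side of `obj_step_le`.
  have hI : Integrable (fun ω => p.obj (x ω - γ •
      (mean (fun i => gradient (p.localObj i) (z i ω)) + mean fun i => v i ω))) P := by
    refine (J5.norm.add (integrable_const |p.fStar|)).mono' hmeas
      (Filter.Eventually.of_forall fun ω => ?_)
    have h1 := hp.fStar_le (x ω - γ •
      (mean (fun i => gradient (p.localObj i) (z i ω)) + mean fun i => v i ω))
    rw [Real.norm_eq_abs]
    refine abs_le.2 ⟨le_trans ?_ h1, ((hle ω).trans (le_abs_self _)).trans
      (le_add_of_nonneg_right (abs_nonneg _))⟩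
    refine le_trans (b := -|p.fStar|) (neg_le_neg ?_) (neg_abs_le _)
    exact le_add_of_nonneg_left (norm_nonneg _)
  refine ⟨hI, (integral_mono hI J5 hle).trans ?_⟩
  rw [integral_add' J4 (I3.const_mul _), integral_add' J3 (I2.const_mul _),
    integral_sub' J2 (I1.const_mul _), integral_add' J1
      (((I5.const_mul _).const_mul _).const_mul _), integral_sub' hint (I4.const_mul _)]
  simp only [integral_const_mul]
  rw [Z1, Z2, integral_finsetSum _ fun i _ => (hzx i).norm.integrable_sq]
  have h6 : L * γ ^ 2 / 2 * ∫ ω, ‖mean fun i => v i ω‖ ^ 2 ∂P ≤ L * γ ^ 2 / 2 * (σ ^ 2 / n) := by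
    gcongr
  linarith

end Step

/-! ### Fresh samples -/

section Independence

variable {Ω α β δ : Type*} [MeasurableSpace Ω] [MeasurableSpace α] [MeasurableSpace β]
  [MeasurableSpace δ] {P : Measure Ω}

theorem indepFun_of_measurable_comap {W : Ω → α} {Y : Ω → β} {η : Ω → δ} (h : IndepFun W η P)
    (hY : @Measurable Ω β (MeasurableSpace.comap W inferInstance) _ Y) : IndepFun Y η P := by
  rw [IndepFun_iff_Indep] at h ⊢
  exact indep_of_indep_of_le_left h hY.comap_le

/-- The joint law is a triple product, which may be reassociated. -/
theorem indepFun_prodMk_of_indepFun [IsProbabilityMeasure P] {A : Ω → α} {B : Ω → β} {C : Ω → δ} (hA : Measurable A)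
    (hB : Measurable B) (hC : Measurable C) (h : IndepFun A (fun ω => (B ω, C ω)) P)
    (hBC : IndepFun B C P) : IndepFun (fun ω => (A ω, B ω)) C P := by
  have := Measure.isProbabilityMeasure_map (μ := P) hA.aemeasurable
  have := Measure.isProbabilityMeasure_map (μ := P) hB.aemeasurable
  have := Measure.isProbabilityMeasure_map (μ := P) hC.aemeasurable
  have hAB : IndepFun A B P := h.comp measurable_id measurable_fst
  rw [indepFun_iff_map_prod_eq_prod_map_map (hA.prodMk hB).aemeasurable hC.aemeasurable,
    hAB.map_prod_eq_prod_map_map hA.aemeasurable hB.aemeasurable]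
  have h1 := h.map_prod_eq_prod_map_map hA.aemeasurable (hB.prodMk hC).aemeasurable
  rw [hBC.map_prod_eq_prod_map_map hB.aemeasurable hC.aemeasurable] at h1
  have h2 := (measurePreserving_prodAssoc (P.map A) (P.map B) (P.map C)).symm
  rw [← h2.map_eq, ← h1, Measure.map_map (MeasurableEquiv.measurable _)
    (hA.prodMk (hB.prodMk hC))]
  rfl

end Independence

/-! ### Variance and unbiasedness at a random query point -/

section Noise

variable {d : ℕ} {Ω Ξ : Type*} [MeasurableSpace Ω] [MeasurableSpace Ξ] {P : Measure Ω}
  [IsProbabilityMeasure P] {D : Measure Ξ} {φ : Vec d → Ξ → Vec d} {σ : ℝ}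

/-- The joint law of point and sample is a product, so Tonelli allows integrating over the sample
with the point frozen. -/
theorem memLp_noise [IsProbabilityMeasure D] {Z : Ω → Vec d} {η : Ω → Ξ} (hZ : Measurable Z)
    (hη : Measurable η) (hlaw : P.map η = D) (hind : IndepFun Z η P)
    (hφ : Measurable fun q : Vec d × Ξ => φ q.1 q.2) (hφ2 : ∀ z, MemLp (φ z) 2 D)
    (hvar : ∀ z, ∫ u, ‖φ z u‖ ^ 2 ∂D ≤ σ ^ 2) :
    MemLp (fun ω => φ (Z ω) (η ω)) 2 P ∧ ∫ ω, ‖φ (Z ω) (η ω)‖ ^ 2 ∂P ≤ σ ^ 2 := by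
  have hm : Measurable fun ω => φ (Z ω) (η ω) := hφ.comp (hZ.prodMk hη)
  have := Measure.isProbabilityMeasure_map (μ := P) hZ.aemeasurable
  have hmap := hind.map_prod_eq_prod_map_map hZ.aemeasurable hη.aemeasurable
  rw [hlaw] at hmap
  have hφm : Measurable fun q : Vec d × Ξ => ENNReal.ofReal (‖φ q.1 q.2‖ ^ 2) :=
    (hφ.norm.pow_const 2).ennreal_ofReal
  have h1 : ∫⁻ ω, ENNReal.ofReal (‖φ (Z ω) (η ω)‖ ^ 2) ∂P ≤ ENNReal.ofReal (σ ^ 2) := by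
    rw [← lintegral_map (f := fun q : Vec d × Ξ => ENNReal.ofReal (‖φ q.1 q.2‖ ^ 2))
      (g := fun ω => (Z ω, η ω)) hφm (hZ.prodMk hη), hmap,
      lintegral_prod _ hφm.aemeasurable]
    calc _ ≤ ∫⁻ _z, ENNReal.ofReal (σ ^ 2) ∂(P.map Z) := by
          refine lintegral_mono fun z => ?_
          dsimp only
          rw [← ofReal_integral_eq_lintegral_ofReal (hφ2 z).norm.integrable_sq
            (Filter.Eventually.of_forall fun _ => by positivity)]
          exact ENNReal.ofReal_le_ofReal (hvar z)
      _ = _ := by simp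
  have h2 : Integrable (fun ω => ‖φ (Z ω) (η ω)‖ ^ 2) P := by
    refine ⟨(hm.norm.pow_const 2).aestronglyMeasurable, ?_⟩
    rw [hasFiniteIntegral_iff_ofReal (Filter.Eventually.of_forall fun _ => by positivity)]
    exact h1.trans_lt ENNReal.ofReal_lt_top
  refine ⟨(memLp_two_iff_integrable_sq_norm hm.aestronglyMeasurable).2 h2, ?_⟩
  rw [← ENNReal.ofReal_le_ofReal_iff (sq_nonneg σ), ofReal_integral_eq_lintegral_ofReal h2
    (Filter.Eventually.of_forall fun _ => by positivity)]
  exact h1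

theorem integral_inner_noise_eq_zero [IsProbabilityMeasure D] {Y Z : Ω → Vec d} {η : Ω → Ξ}
    (hY : Measurable Y) (hZ : Measurable Z) (hη : Measurable η) (hlaw : P.map η = D)
    (hind : IndepFun (fun ω => (Y ω, Z ω)) η P)
    (hφ : Measurable fun q : Vec d × Ξ => φ q.1 q.2) (hφ2 : ∀ z, MemLp (φ z) 2 D)
    (hmean : ∀ z, ∫ u, φ z u ∂D = 0) (hY2 : MemLp Y 2 P)
    (hν : MemLp (fun ω => φ (Z ω) (η ω)) 2 P) :
    ∫ ω, inner ℝ (Y ω) (φ (Z ω) (η ω)) ∂P = 0 := by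
  have hYZ := hY.prodMk hZ
  have := Measure.isProbabilityMeasure_map (μ := P) hYZ.aemeasurable
  have hmap := hind.map_prod_eq_prod_map_map hYZ.aemeasurable hη.aemeasurable
  rw [hlaw] at hmap
  have hm : Measurable fun q : (Vec d × Vec d) × Ξ => (inner ℝ q.1.1 (φ q.1.2 q.2) : ℝ) :=
    measurable_fst.fst.inner (hφ.comp (measurable_fst.snd.prodMk measurable_snd))
  have h1 := integral_map (μ := P) (hYZ.prodMk hη).aemeasurable hm.aestronglyMeasurable
  have h2 : Integrable (fun q : (Vec d × Vec d) × Ξ => (inner ℝ q.1.1 (φ q.1.2 q.2) : ℝ))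
      (P.map fun ω => ((Y ω, Z ω), η ω)) :=
    (integrable_map_measure hm.aestronglyMeasurable (hYZ.prodMk hη).aemeasurable).2
      (integrable_inner hY2 hν)
  rw [← h1, hmap, integral_prod _ (hmap ▸ h2)]
  refine integral_eq_zero_of_ae (Filter.Eventually.of_forall fun q => ?_)
  have h3 := integral_inner ((hφ2 q.2).integrable (by norm_num)) q.1 (𝕜 := ℝ)
  simp only [h3, hmean, inner_zero_right, Pi.zero_apply]

end Noise

namespace Problem.Sampling

variable {n d : ℕ} {Ω Ξ : Type*} [MeasurableSpace Ξ] {ξ : ℕ → Fin n → Ω → Ξ} {x₀ : Ω → Vec d}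

/-- The samples of the iterations up to `k`, except the one of agent `i` in iteration `k`. -/
def others (n k : ℕ) (i : Fin n) : Finset (ℕ × Fin n) :=
  (Finset.range (k + 1) ×ˢ Finset.univ).erase (k, i)

/-- The initial point and the samples of the iterations up to `k`, except the one of agent `i` in
iteration `k`. -/
def information (ξ : ℕ → Fin n → Ω → Ξ) (x₀ : Ω → Vec d) (k : ℕ) (i : Fin n) (ω : Ω) :
    Vec d × (others n k i → Ξ) :=
  (x₀ ω, fun q => ξ q.1.1 q.1.2 ω)

/-- The σ-algebra generated by `information`. -/
abbrev informationAlgebra (ξ : ℕ → Fin n → Ω → Ξ) (x₀ : Ω → Vec d) (k : ℕ) (i : Fin n) :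
    MeasurableSpace Ω :=
  MeasurableSpace.comap (information ξ x₀ k i) inferInstance

theorem measurable_init_information (k : ℕ) (i : Fin n) :
    Measurable[informationAlgebra ξ x₀ k i] x₀ :=
  measurable_fst.comp (comap_measurable (information ξ x₀ k i))

theorem measurable_sample_information {k l : ℕ} {i j : Fin n} (hl : l ≤ k) (hne : (l, j) ≠ (k, i)) :
    Measurable[informationAlgebra ξ x₀ k i] (ξ l j) := by
  have hmem : (l, j) ∈ others n k i := by
    simp only [others, Finset.mem_erase, Finset.mem_product, Finset.mem_range, Finset.mem_univ]
    exact ⟨hne, by omega, trivial⟩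
  exact ((measurable_pi_apply (⟨(l, j), hmem⟩ : others n k i)).comp measurable_snd).comp
    (comap_measurable (information ξ x₀ k i))

/-- Keeping the other agents' samples of iteration `k` in the information lets one independence
statement yield both orthogonality to the past and orthogonality between agents. -/
theorem indepFun_information [MeasurableSpace Ω] {P : Measure Ω} {p : Problem n d Ξ}
    [IsProbabilityMeasure P] (h : p.Sampling P ξ x₀) (k : ℕ) (i : Fin n) :
    IndepFun (information ξ x₀ k i) (ξ k i) P := by
  have hB : Measurable fun ω (q : others n k i) => ξ q.1.1 q.1.2 ω :=
    measurable_pi_iff.2 fun q => h.measurable_sample _ _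
  refine indepFun_prodMk_of_indepFun h.measurable_init hB (h.measurable_sample k i) ?_ ?_
  · exact h.indep_init.comp (ψ := fun u : ℕ × Fin n → Ξ =>
      ((fun q : others n k i => u q.1), u (k, i))) measurable_id
      ((measurable_pi_iff.2 fun q => measurable_pi_apply _).prodMk (measurable_pi_apply _))
  · have h1 := h.indep.indepFun_finset (others n k i) {(k, i)}
      (by simp [others]) fun q => h.measurable_sample q.1 q.2
    exact h1.comp (ψ := fun u : ({(k, i)} : Finset (ℕ × Fin n)) → Ξ =>
      u ⟨(k, i), Finset.mem_singleton_self _⟩) measurable_id (measurable_pi_apply _)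

end Problem.Sampling

/-! ### The iterates for fixed samples -/

section Deterministic

variable {n d : ℕ} {Ξ : Type*} [MeasurableSpace Ξ] {p : Problem n d Ξ} {m : PortModel} {γ : ℝ}

/-- The deviations of a state from the average of its models. -/
noncomputable def deviation (S : State n d) : (Fin n → Vec d) × (Fin n → Vec d) :=
  (fun i => S.x i - mean S.x, fun i => S.y i - mean S.x)

theorem transmitted_deviation (r : ℕ) (S : State n d) (i : Fin n) :
    transmitted r (deviation S) i = zArray r S i - mean S.x := by
  unfold transmitted zArray deviation
  split_ifs <;> rfl

theorem mean_zArray {S : State n d} (h : mean S.y = mean S.x) (r : ℕ) :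
    mean (zArray r S) = mean S.x := by
  unfold zArray
  split_ifs
  exacts [rfl, h]

theorem mean_averagingStep (hn : 0 < n) {S : State n d} (h : mean S.y = mean S.x) (r : ℕ)
    (u : Fin n → Ξ) :
    mean (averagingStep p γ r u S).x = mean S.x - γ • mean (eArray p r u S) ∧
      mean (averagingStep p γ r u S).y = mean S.x - γ • mean (eArray p r u S) ∧
      deviation (averagingStep p γ r u S) = 0 := by
  have h1 : ∀ v : Fin n → Vec d, mean (fun j => v j - γ • eArray p r u S j) =
      mean v - γ • mean (eArray p r u S) := fun v => by rw [mean_sub, mean_smul]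
  refine ⟨?_, ?_, ?_⟩
  · simp only [averagingStep, mean_const hn, h1]
  · simp only [averagingStep, mean_const hn, h1, h]
  · unfold deviation
    ext i : 2 <;> simp [averagingStep, mean_const hn, h1, h]

variable [NeZero n]

theorem cecaStep_eq_mix (r : ℕ) (u : Fin n → Ξ) (S : State n d) :
    ((cecaStep p m γ r u S).x, (cecaStep p m γ r u S).y) =
      mix m r ((S.x, S.y) - γ • (eArray p r u S, eArray p r u S)) := by
  have h : transmitted r ((S.x, S.y) - γ • (eArray p r u S, eArray p r u S)) =
      fun j => zArray r S j - γ • eArray p r u S j := by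
    unfold transmitted zArray
    split_ifs <;> rfl
  unfold mix
  rw [h]
  simp only [cecaStep,
    sum_commMatrix_smul r m (fun j => zArray r S j - γ • eArray p r u S j)]
  rfl

theorem mean_cecaStep (hm : m.Allows n) {S : State n d} (h : mean S.y = mean S.x) (r : ℕ)
    (u : Fin n → Ξ) :
    mean (cecaStep p m γ r u S).x = mean S.x - γ • mean (eArray p r u S) ∧
      mean (cecaStep p m γ r u S).y = mean S.x - γ • mean (eArray p r u S) := by
  have h1 : ∀ v : Fin n → Vec d, mean (fun j => v j - γ • eArray p r u S j) =
      mean v - γ • mean (eArray p r u S) := fun v => by rw [mean_sub, mean_smul]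
  have h2 : mean (fun i => zArray r S (partner n r m i) - γ • eArray p r u S (partner n r m i)) =
      mean S.x - γ • mean (eArray p r u S) := by
    rw [← mean_zArray h r, ← h1 (zArray r S), mean, mean]
    congr 1
    exact (partner_bijective hm r).sum_comp fun j => zArray r S j - γ • eArray p r u S j
  constructor <;>
  · simp only [cecaStep,
      sum_commMatrix_smul r m (fun j => zArray r S j - γ • eArray p r u S j)]
    rw [mean_add, mean_smul, mean_smul, h2, h1]
    try rw [h]
    module

/-- Mixing is linear and fixes constant pairs, so the new common mean can be subtracted before
mixing. -/
theorem deviation_cecaStep (hm : m.Allows n) {S : State n d} (h : mean S.y = mean S.x) (r : ℕ)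
    (u : Fin n → Ξ) :
    deviation (cecaStep p m γ r u S) = mix m r (deviation S -
      γ • (fun i => eArray p r u S i - mean (eArray p r u S),
        fun i => eArray p r u S i - mean (eArray p r u S))) := by
  have h1 : deviation (cecaStep p m γ r u S) =
      ((cecaStep p m γ r u S).x, (cecaStep p m γ r u S).y) -
        (fun _ => mean S.x - γ • mean (eArray p r u S),
          fun _ => mean S.x - γ • mean (eArray p r u S)) := by
    unfold deviation
    rw [(mean_cecaStep hm h r u).1]
    rfl
  rw [h1, cecaStep_eq_mix, ← mix_const m r (mean S.x - γ • mean (eArray p r u S)), ← mix_sub]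
  congr 1
  unfold deviation
  ext i : 2 <;> simp <;> module

/-- Partners form a permutation, so both arrays make the same mean step; one centre serves for both.
-/
theorem mean_y_iterates (hm : m.Allows n) (s : ℕ) (u : ℕ → Fin n → Ξ) (x₀ : Vec d) (k : ℕ) :
    mean (iterates p m γ s u x₀ k).y = mean (iterates p m γ s u x₀ k).x := by
  induction k with
  | zero => rfl
  | succ k ih =>
    rw [iterates]
    split_ifs
    · have h := mean_averagingStep (p := p) (γ := γ) (NeZero.pos n) ih (k % tau n) (u k)
      exact h.2.1.trans h.1.symm
    · have h := mean_cecaStep (p := p) (γ := γ) hm ih (k % tau n) (u k)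
      exact h.2.trans h.1.symm

theorem mean_x_iterates_succ (hm : m.Allows n) (s : ℕ) (u : ℕ → Fin n → Ξ) (x₀ : Vec d) (k : ℕ) :
    mean (iterates p m γ s u x₀ (k + 1)).x = mean (iterates p m γ s u x₀ k).x -
      γ • mean (eArray p (k % tau n) (u k) (iterates p m γ s u x₀ k)) := by
  have ih := mean_y_iterates (p := p) (γ := γ) hm s u x₀ k
  rw [iterates]
  split_ifs
  · exact (mean_averagingStep (NeZero.pos n) ih _ _).1
  · exact (mean_cecaStep hm ih _ _).1

theorem deviation_iterates_succ (hm : m.Allows n) (s : ℕ) (u : ℕ → Fin n → Ξ) (x₀ : Vec d)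
    (k : ℕ) :
    deviation (iterates p m γ s u x₀ (k + 1)) =
      if k < s then 0 else mix m (k % tau n) (deviation (iterates p m γ s u x₀ k) -
      γ • (fun i => eArray p (k % tau n) (u k) (iterates p m γ s u x₀ k) i -
          mean (eArray p (k % tau n) (u k) (iterates p m γ s u x₀ k)),
        fun i => eArray p (k % tau n) (u k) (iterates p m γ s u x₀ k) i -
          mean (eArray p (k % tau n) (u k) (iterates p m γ s u x₀ k)))) := by
  have ih := mean_y_iterates (p := p) (γ := γ) hm s u x₀ k
  rw [iterates]
  split_ifs
  · exact (mean_averagingStep (NeZero.pos n) ih _ _).2.2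
  · exact deviation_cecaStep hm ih _ _

theorem sum_norm_zArray_sub_mean_sq_le (hn : 2 ≤ n) (hm : m.Allows n) (hγ : 0 ≤ γ) {s : ℕ}
    (hs : s ≤ tau n) (u : ℕ → Fin n → Ξ) (x₀ : Vec d) (k : ℕ) :
    ∑ i, ‖zArray (k % tau n) (iterates p m γ s u x₀ k) i -
        mean (iterates p m γ s u x₀ k).x‖ ^ 2 ≤
      2 * γ ^ 2 * tau n * ∑ l ∈ Finset.Ico (k - 2 * tau n) k,
        ∑ i, ‖eArray p (l % tau n) (u l) (iterates p m γ s u x₀ l) i -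
          mean (eArray p (l % tau n) (u l) (iterates p m γ s u x₀ l))‖ ^ 2 := by
  have h := sum_norm_sq_transmitted_le hn hm hγ (X := fun k => deviation (iterates p m γ s u x₀ k))
    (h := fun l i => eArray p (l % tau n) (u l) (iterates p m γ s u x₀ l) i -
          mean (eArray p (l % tau n) (u l) (iterates p m γ s u x₀ l))) hs ?_ ?_ ?_ ?_ k
  · simpa only [transmitted_deviation] using h
  · unfold deviation iterates
    ext i : 2 <;> simp [mean_const (NeZero.pos n)]
  · intro k hk
    simp only [deviation_iterates_succ hm, hk, if_true]
  · intro k hk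
    simp only [deviation_iterates_succ hm, not_lt.2 hk, if_false]
  · exact fun k => sum_sub_mean (NeZero.pos n) _

end Deterministic

/-! ### The random iterates -/

section Random

variable {n d : ℕ} {Ω Ξ : Type*} [MeasurableSpace Ξ] {p : Problem n d Ξ} {m : PortModel} {γ : ℝ}
  {s : ℕ} {ξ : ℕ → Fin n → Ω → Ξ} {x₀ : Ω → Vec d}

theorem measurable_zArray {_ : MeasurableSpace Ω} {S : Ω → State n d}
    (hx : ∀ i, Measurable fun ω => (S ω).x i) (hy : ∀ i, Measurable fun ω => (S ω).y i) (r : ℕ)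
    (i : Fin n) : Measurable fun ω => zArray r (S ω) i := by
  unfold zArray
  split_ifs
  exacts [hx i, hy i]

theorem measurable_eArray {_ : MeasurableSpace Ω} (hp : p.WellPosed) {S : Ω → State n d}
    {u : Fin n → Ω → Ξ} (hx : ∀ i, Measurable fun ω => (S ω).x i)
    (hy : ∀ i, Measurable fun ω => (S ω).y i) (r : ℕ) {i : Fin n} (hu : Measurable (u i)) :
    Measurable fun ω => eArray p r (fun j => u j ω) (S ω) i :=
  hp.measurable.comp ((measurable_zArray hx hy r i).prodMk hu)

theorem measurable_cecaStep {_ : MeasurableSpace Ω} {S : Ω → State n d} {u : Ω → Fin n → Ξ} {r : ℕ}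
    (hx : ∀ i, Measurable fun ω => (S ω).x i) (hy : ∀ i, Measurable fun ω => (S ω).y i)
    (hz : ∀ i, Measurable fun ω => zArray r (S ω) i)
    (he : ∀ i, Measurable fun ω => eArray p r (u ω) (S ω) i) :
    (∀ i, Measurable fun ω => (cecaStep p m γ r (u ω) (S ω)).x i) ∧
      ∀ i, Measurable fun ω => (cecaStep p m γ r (u ω) (S ω)).y i := by
  have hcomb : ∀ (a c : ℝ) {f g : Ω → Vec d}, Measurable f → Measurable g →
      Measurable fun ω => a • f ω + c • g ω :=
    fun a c _ _ hf hg => (hf.const_smul a).add (hg.const_smul c)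
  have hg : ∀ {f : Ω → Vec d}, Measurable f → ∀ i,
      Measurable fun ω => f ω - γ • eArray p r (u ω) (S ω) i :=
    fun hf i => hf.sub ((he i).const_smul γ)
  have hsum : ∀ i, Measurable fun ω => ∑ j, commMatrix n r m i j •
      (zArray r (S ω) j - γ • eArray p r (u ω) (S ω) j) := fun i =>
    Finset.measurable_fun_sum _ fun j _ => (hg (hz j) j).const_smul (commMatrix n r m i j)
  exact ⟨fun i => hcomb _ _ (hg (hx i) i) (hsum i), fun i => hcomb _ _ (hg (hy i) i) (hsum i)⟩

/-- The σ-algebra is arbitrary: the lemma serves both the ambient one and `informationAlgebra`. -/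
theorem measurable_iterates {_ : MeasurableSpace Ω} (hp : p.WellPosed) (hx₀ : Measurable x₀) {k : ℕ}
    (hξ : ∀ l < k, ∀ j, Measurable (ξ l j)) :
    (∀ i, Measurable fun ω => (iterates p m γ s (fun l j => ξ l j ω) (x₀ ω) k).x i) ∧
      ∀ i, Measurable fun ω => (iterates p m γ s (fun l j => ξ l j ω) (x₀ ω) k).y i := by
  induction k with
  | zero => exact ⟨fun _ => hx₀, fun _ => hx₀⟩
  | succ k ih =>
    obtain ⟨hx, hy⟩ := ih fun l hl => hξ l (by omega)
    have hz := measurable_zArray hx hy (k % tau n)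
    have he := fun i => measurable_eArray hp hx hy (k % tau n) (hξ k (by omega) i)
    simp only [iterates]
    split_ifs
    · exact ⟨fun i => measurable_mean fun j => (hx j).sub ((he j).const_smul γ),
        fun i => measurable_mean fun j => (hy j).sub ((he j).const_smul γ)⟩
    · exact measurable_cecaStep hx hy hz he

end Random

/-! ### Expected descent and expected consensus error -/

section RandomIterates

variable {n d : ℕ} {Ω Ξ : Type*} [MeasurableSpace Ξ]

/-- The random state of the algorithm. -/
noncomputable def randomState (p : Problem n d Ξ) (m : PortModel) (γ : ℝ) (s : ℕ)
    (ξ : ℕ → Fin n → Ω → Ξ) (x₀ : Ω → Vec d) (k : ℕ) (ω : Ω) : State n d :=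
  iterates p m γ s (fun l j => ξ l j ω) (x₀ ω) k

/-- The average model. -/
noncomputable def center (p : Problem n d Ξ) (m : PortModel) (γ : ℝ) (s : ℕ)
    (ξ : ℕ → Fin n → Ω → Ξ) (x₀ : Ω → Vec d) (k : ℕ) (ω : Ω) : Vec d :=
  mean (randomState p m γ s ξ x₀ k ω).x

/-- The point at which agent `i` evaluates its gradient. -/
noncomputable def queryPoint (p : Problem n d Ξ) (m : PortModel) (γ : ℝ) (s : ℕ)
    (ξ : ℕ → Fin n → Ω → Ξ) (x₀ : Ω → Vec d) (k : ℕ) (i : Fin n) (ω : Ω) : Vec d :=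
  zArray (k % tau n) (randomState p m γ s ξ x₀ k ω) i

/-- The stochastic gradient of agent `i`. -/
noncomputable def sampledGradient (p : Problem n d Ξ) (m : PortModel) (γ : ℝ) (s : ℕ)
    (ξ : ℕ → Fin n → Ω → Ξ) (x₀ : Ω → Vec d) (k : ℕ) (i : Fin n) (ω : Ω) : Vec d :=
  eArray p (k % tau n) (fun j => ξ k j ω) (randomState p m γ s ξ x₀ k ω) i

/-- The error of the stochastic gradient of agent `i`. -/
noncomputable def gradientError (p : Problem n d Ξ) (m : PortModel) (γ : ℝ) (s : ℕ)
    (ξ : ℕ → Fin n → Ω → Ξ) (x₀ : Ω → Vec d) (k : ℕ) (i : Fin n) (ω : Ω) : Vec d :=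
  sampledGradient p m γ s ξ x₀ k i ω -
    gradient (p.localObj i) (queryPoint p m γ s ξ x₀ k i ω)

variable {p : Problem n d Ξ} {m : PortModel} {γ L σ b : ℝ} {s : ℕ} {ξ : ℕ → Fin n → Ω → Ξ}
  {x₀ : Ω → Vec d}

theorem measurable_center {_ : MeasurableSpace Ω} (hp : p.WellPosed) (hx₀ : Measurable x₀) {k : ℕ}
    (hξ : ∀ l < k, ∀ j, Measurable (ξ l j)) : Measurable (center p m γ s ξ x₀ k) :=
  measurable_mean (measurable_iterates hp hx₀ hξ).1

theorem measurable_queryPoint {_ : MeasurableSpace Ω} (hp : p.WellPosed) (hx₀ : Measurable x₀)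
    {k : ℕ} (hξ : ∀ l < k, ∀ j, Measurable (ξ l j)) (i : Fin n) :
    Measurable (queryPoint p m γ s ξ x₀ k i) :=
  measurable_zArray (measurable_iterates hp hx₀ hξ).1 (measurable_iterates hp hx₀ hξ).2 _ i

theorem measurable_sampledGradient {_ : MeasurableSpace Ω} (hp : p.WellPosed)
    (hx₀ : Measurable x₀) {k : ℕ} (hξ : ∀ l < k, ∀ j, Measurable (ξ l j)) {i : Fin n}
    (hi : Measurable (ξ k i)) : Measurable (sampledGradient p m γ s ξ x₀ k i) :=
  measurable_eArray hp (measurable_iterates hp hx₀ hξ).1 (measurable_iterates hp hx₀ hξ).2 _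
    (u := ξ k) hi

theorem measurable_gradientError {_ : MeasurableSpace Ω} (hp : p.WellPosed)
    (hs : p.LipschitzSmooth L) (hx₀ : Measurable x₀) {k : ℕ}
    (hξ : ∀ l < k, ∀ j, Measurable (ξ l j)) {i : Fin n} (hi : Measurable (ξ k i)) :
    Measurable (gradientError p m γ s ξ x₀ k i) :=
  (measurable_sampledGradient hp hx₀ hξ hi).sub
    ((hs.measurable_gradient i).comp (measurable_queryPoint hp hx₀ hξ i))

variable [MeasurableSpace Ω] {P : Measure Ω}

theorem memLp_mix [NeZero n] {D : Ω → (Fin n → Vec d) × (Fin n → Vec d)} (r : ℕ)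
    (h₁ : ∀ i, MemLp (fun ω => (D ω).1 i) 2 P) (h₂ : ∀ i, MemLp (fun ω => (D ω).2 i) 2 P) :
    (∀ i, MemLp (fun ω => (mix m r (D ω)).1 i) 2 P) ∧
      ∀ i, MemLp (fun ω => (mix m r (D ω)).2 i) 2 P := by
  have ht : ∀ i, MemLp (fun ω => transmitted r (D ω) i) 2 P := by
    intro i
    unfold transmitted
    split_ifs
    exacts [h₁ i, h₂ i]
  exact ⟨fun i => ((h₁ i).const_smul (weightA n r)).add ((ht _).const_smul (1 - weightA n r)),
    fun i => ((h₂ i).const_smul (weightB n r)).add ((ht _).const_smul (1 - weightB n r))⟩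

theorem memLp_queryPoint_sub {k : ℕ}
    (h₁ : ∀ i, MemLp (fun ω => (deviation (randomState p m γ s ξ x₀ k ω)).1 i) 2 P)
    (h₂ : ∀ i, MemLp (fun ω => (deviation (randomState p m γ s ξ x₀ k ω)).2 i) 2 P) (i : Fin n) :
    MemLp (fun ω => queryPoint p m γ s ξ x₀ k i ω - center p m γ s ξ x₀ k ω) 2 P := by
  unfold queryPoint center
  simp only [← transmitted_deviation]
  unfold transmitted
  split_ifs
  exacts [h₁ i, h₂ i]

variable [IsProbabilityMeasure P]

theorem memLp_gradientError (hp : p.WellPosed) (hs : p.LipschitzSmooth L) (hg : p.GradientNoise σ)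
    (hS : p.Sampling P ξ x₀) (k : ℕ) (i : Fin n) :
    MemLp (gradientError p m γ s ξ x₀ k i) 2 P ∧
      ∫ ω, ‖gradientError p m γ s ξ x₀ k i ω‖ ^ 2 ∂P ≤ σ ^ 2 := by
  have := hp.isProb i
  refine memLp_noise (D := p.D i) (φ := fun z u => p.stochGrad z u - gradient (p.localObj i) z)
    (measurable_queryPoint hp hS.measurable_init (fun l _ j => hS.measurable_sample l j) i)
    (hS.measurable_sample k i) (hS.law k i) (indepFun_of_measurable_comap
      (hS.indepFun_information k i) (measurable_queryPoint hp
        (Problem.Sampling.measurable_init_information k i) (fun l hl j =>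
        Problem.Sampling.measurable_sample_information hl.le (by simp [hl.ne])) i))
    (hp.measurable.sub ((hs.measurable_gradient i).comp measurable_fst))
    (fun z => (hg.memLp i z).sub (memLp_const _)) (hg.variance i)

theorem integral_inner_gradientError (hp : p.WellPosed) (hs : p.LipschitzSmooth L)
    (hg : p.GradientNoise σ) (hS : p.Sampling P ξ x₀) (k : ℕ) (i : Fin n) {Y : Ω → Vec d}
    (hY : Measurable[Problem.Sampling.informationAlgebra ξ x₀ k i] Y) (hYm : Measurable Y)
    (hY2 : MemLp Y 2 P) :
    ∫ ω, inner ℝ (Y ω) (gradientError p m γ s ξ x₀ k i ω) ∂P = 0 := by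
  have := hp.isProb i
  refine integral_inner_noise_eq_zero (D := p.D i)
    (φ := fun z u => p.stochGrad z u - gradient (p.localObj i) z) hYm
    (measurable_queryPoint hp hS.measurable_init (fun l _ j => hS.measurable_sample l j) i)
    (hS.measurable_sample k i) (hS.law k i) (indepFun_of_measurable_comap
      (hS.indepFun_information k i) (hY.prodMk (measurable_queryPoint hp
        (Problem.Sampling.measurable_init_information k i) (fun l hl j =>
        Problem.Sampling.measurable_sample_information hl.le (by simp [hl.ne])) i)))
    (hp.measurable.sub ((hs.measurable_gradient i).comp measurable_fst))
    (fun z => (hg.memLp i z).sub (memLp_const _)) (fun z => ?_) hY2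
    (memLp_gradientError hp hs hg hS k i).1
  rw [integral_sub ((hg.memLp i z).integrable (by norm_num)) (integrable_const _), hg.unbiased]
  simp

theorem descent [NeZero n] (hL : 0 < L) (hm : m.Allows n) (hγ : 0 ≤ γ) (hLγ : L * γ ≤ 1)
    (hp : p.WellPosed) (hs : p.LipschitzSmooth L) (hg : p.GradientNoise σ)
    (hS : p.Sampling P ξ x₀) {k : ℕ}
    (hint : Integrable (fun ω => p.obj (center p m γ s ξ x₀ k ω)) P)
    (hdev : ∀ i, MemLp (fun ω => queryPoint p m γ s ξ x₀ k i ω - center p m γ s ξ x₀ k ω) 2 P) :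
    Integrable (fun ω => p.obj (center p m γ s ξ x₀ (k + 1) ω)) P ∧
    ∫ ω, p.obj (center p m γ s ξ x₀ (k + 1) ω) ∂P ≤ ∫ ω, p.obj (center p m γ s ξ x₀ k ω) ∂P
      - γ / 2 * ∫ ω, ‖gradient p.obj (center p m γ s ξ x₀ k ω)‖ ^ 2 ∂P
      + γ / 2 * (L ^ 2 * (1 / (n : ℝ) *
        ∑ i, ∫ ω, ‖queryPoint p m γ s ξ x₀ k i ω - center p m γ s ξ x₀ k ω‖ ^ 2 ∂P))
      + L * γ ^ 2 / 2 * (σ ^ 2 / n) := by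
  have hn := NeZero.pos n
  have hξ : ∀ l < k, ∀ j, Measurable (ξ l j) := fun l _ j => hS.measurable_sample l j
  have hx := measurable_center (m := m) (γ := γ) (s := s) hp hS.measurable_init hξ
  have hz := fun i => measurable_queryPoint (m := m) (γ := γ) (s := s) hp hS.measurable_init hξ i
  have hi₀ := fun i => Problem.Sampling.measurable_init_information (ξ := ξ) (x₀ := x₀) k i
  have hiξ : ∀ i, ∀ l < k, ∀ j, Measurable[Problem.Sampling.informationAlgebra ξ x₀ k i] (ξ l j) :=
    fun i l hl j => Problem.Sampling.measurable_sample_information hl.le (by simp [hl.ne])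
  have hstep : ∀ ω, center p m γ s ξ x₀ (k + 1) ω = center p m γ s ξ x₀ k ω - γ • mean fun i =>
      gradient (p.localObj i) (queryPoint p m γ s ξ x₀ k i ω) +
        gradientError p m γ s ξ x₀ k i ω := by
    intro ω
    simp only [gradientError, add_sub_cancel]
    exact mean_x_iterates_succ hm s _ _ k
  simp only [hstep]
  refine integral_obj_step_le hL hn hp hs hγ hLγ hx hz hint hdev
    (fun i => (memLp_gradientError hp hs hg hS k i).1)
    (fun i => (memLp_gradientError hp hs hg hS k i).2) (fun i j hij => ?_) (fun i hA => ?_)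
    fun i hG => ?_
  · exact integral_inner_gradientError hp hs hg hS k j
      (measurable_gradientError hp hs (hi₀ j) (hiξ j)
        (Problem.Sampling.measurable_sample_information le_rfl (by simp [hij])))
      (measurable_gradientError hp hs hS.measurable_init hξ (hS.measurable_sample k i))
      (memLp_gradientError hp hs hg hS k i).1
  · exact integral_inner_gradientError hp hs hg hS k i
      ((hs.measurable_gradient_obj hn).comp (measurable_center hp (hi₀ i) (hiξ i)))
      ((hs.measurable_gradient_obj hn).comp hx) hA
  · exact integral_inner_gradientError hp hs hg hS k i
      (measurable_mean fun j => (hs.measurable_gradient j).comp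
        (measurable_queryPoint hp (hi₀ i) (hiξ i) j))
      (measurable_mean fun j => (hs.measurable_gradient j).comp (hz j)) hG

/-- The mean minimizes the sum of squared distances, so the gradients may be recentred at `∇f(x̄)`.
What remains splits into drift, heterogeneity and noise, whence the factor `3`. -/
theorem memLp_sampledGradient_sub (hn : 0 < n)
    (hp : p.WellPosed) (hs : p.LipschitzSmooth L) (hg : p.GradientNoise σ)
    (hb : p.DataHeterogeneity b) (hS : p.Sampling P ξ x₀) {k : ℕ}
    (hdev : ∀ i, MemLp (fun ω => queryPoint p m γ s ξ x₀ k i ω - center p m γ s ξ x₀ k ω) 2 P) :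
    (∀ i, MemLp (fun ω => sampledGradient p m γ s ξ x₀ k i ω -
      mean fun j => sampledGradient p m γ s ξ x₀ k j ω) 2 P) ∧
    ∑ i, ∫ ω, ‖sampledGradient p m γ s ξ x₀ k i ω -
      mean fun j => sampledGradient p m γ s ξ x₀ k j ω‖ ^ 2 ∂P ≤
      3 * (L ^ 2 * ∑ i, ∫ ω, ‖queryPoint p m γ s ξ x₀ k i ω - center p m γ s ξ x₀ k ω‖ ^ 2 ∂P
        + n * b ^ 2 + n * σ ^ 2) := by
  have hξ : ∀ l < k, ∀ j, Measurable (ξ l j) := fun l _ j => hS.measurable_sample l j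
  have hx := measurable_center (m := m) (γ := γ) (s := s) hp hS.measurable_init hξ
  have hz := fun i => measurable_queryPoint (m := m) (γ := γ) (s := s) hp hS.measurable_init hξ i
  have hv := fun i => memLp_gradientError (m := m) (γ := γ) (s := s) hp hs hg hS k i
  have hB := fun i => memLp_gradient_sub hs hx (hz i) (hdev i) i
  have hH := fun i => memLp_gradient_sub_obj (P := P) hn hs hb hx i
  have hdec : ∀ i ω, sampledGradient p m γ s ξ x₀ k i ω =
      gradient p.obj (center p m γ s ξ x₀ k ω) +
      ((gradient (p.localObj i) (queryPoint p m γ s ξ x₀ k i ω) -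
        gradient (p.localObj i) (center p m γ s ξ x₀ k ω)) +
      (gradient (p.localObj i) (center p m γ s ξ x₀ k ω) -
        gradient p.obj (center p m γ s ξ x₀ k ω)) + gradientError p m γ s ξ x₀ k i ω) := by
    intro i ω
    unfold gradientError
    abel
  have hsum := fun i => ((hB i).add (hH i)).add (hv i).1
  have hdiff : ∀ i, MemLp (fun ω => sampledGradient p m γ s ξ x₀ k i ω -
      mean fun j => sampledGradient p m γ s ξ x₀ k j ω) 2 P := by
    intro i
    have h1 := (hsum i).sub (memLp_mean hsum)
    refine h1.ae_eq (Filter.Eventually.of_forall fun ω => ?_)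
    simp only [hdec, mean_add, mean_const hn, Pi.sub_apply, Pi.add_apply]
    abel
  refine ⟨hdiff, ?_⟩
  have hle : ∀ ω, ∑ i, ‖sampledGradient p m γ s ξ x₀ k i ω -
      mean fun j => sampledGradient p m γ s ξ x₀ k j ω‖ ^ 2 ≤
      3 * (L ^ 2 * ∑ i, ‖queryPoint p m γ s ξ x₀ k i ω - center p m γ s ξ x₀ k ω‖ ^ 2
        + n * b ^ 2 + ∑ i, ‖gradientError p m γ s ξ x₀ k i ω‖ ^ 2) := by
    intro ω
    refine (sum_norm_sub_mean_sq_le hn _ (gradient p.obj (center p m γ s ξ x₀ k ω))).trans ?_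
    have h1 : ∀ i, ‖sampledGradient p m γ s ξ x₀ k i ω -
        gradient p.obj (center p m γ s ξ x₀ k ω)‖ ^ 2 ≤
        3 * (L ^ 2 * ‖queryPoint p m γ s ξ x₀ k i ω - center p m γ s ξ x₀ k ω‖ ^ 2 +
          ‖gradient (p.localObj i) (center p m γ s ξ x₀ k ω) -
            gradient p.obj (center p m γ s ξ x₀ k ω)‖ ^ 2 +
          ‖gradientError p m γ s ξ x₀ k i ω‖ ^ 2) := by
      intro i
      rw [hdec, add_sub_cancel_left]
      refine (norm_add_three_sq_le _ _ _).trans ?_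
      rw [← mul_pow]
      have := pow_le_pow_left₀ (norm_nonneg _) (hs.lipschitz i (queryPoint p m γ s ξ x₀ k i ω)
        (center p m γ s ξ x₀ k ω)) 2
      linarith
    refine (Finset.sum_le_sum fun i _ => h1 i).trans ?_
    have h2 := hb (center p m γ s ξ x₀ k ω)
    rw [one_div_mul_eq_div, div_le_iff₀ (by positivity), mul_comm] at h2
    rw [← Finset.mul_sum, Finset.sum_add_distrib, Finset.sum_add_distrib, ← Finset.mul_sum]
    linarith
  have hI1 : ∀ i, Integrable (fun ω =>
      ‖queryPoint p m γ s ξ x₀ k i ω - center p m γ s ξ x₀ k ω‖ ^ 2) P :=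
    fun i => (hdev i).norm.integrable_sq
  have hI2 : ∀ i, Integrable (fun ω => ‖gradientError p m γ s ξ x₀ k i ω‖ ^ 2) P :=
    fun i => (hv i).1.norm.integrable_sq
  have hI3 : ∀ i, Integrable (fun ω => ‖sampledGradient p m γ s ξ x₀ k i ω -
      mean fun j => sampledGradient p m γ s ξ x₀ k j ω‖ ^ 2) P :=
    fun i => (hdiff i).norm.integrable_sq
  have hJ1 := (integrable_finsetSum Finset.univ fun i _ => hI1 i).const_mul (L ^ 2)
  have hJ2 := hJ1.add (integrable_const ((n : ℝ) * b ^ 2))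
  have hJ3 := integrable_finsetSum Finset.univ fun i _ => hI2 i
  rw [← integral_finsetSum _ fun i _ => hI3 i]
  refine (integral_mono (integrable_finsetSum Finset.univ fun i _ => hI3 i)
    ((hJ2.add hJ3).const_mul 3) hle).trans ?_
  rw [integral_const_mul, integral_add' hJ2 hJ3, integral_add' hJ1 (integrable_const _),
    integral_const_mul, integral_finsetSum _ fun i _ => hI1 i,
    integral_finsetSum _ fun i _ => hI2 i]
  have h3 : ∑ i, ∫ ω, ‖gradientError p m γ s ξ x₀ k i ω‖ ^ 2 ∂P ≤ n * σ ^ 2 := by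
    simpa using Finset.sum_le_sum fun i (_ : i ∈ Finset.univ) => (hv i).2
  simp only [integral_const, probReal_univ, smul_eq_mul, one_mul]
  linarith

variable [NeZero n]

/-- Integrability of `f(x̄)` and square integrability of the deviations propagate together; `x̄`
itself need not be square integrable. -/
theorem integrable_process (hL : 0 < L) (hm : m.Allows n) (hγ : 0 ≤ γ)
    (hLγ : L * γ ≤ 1) (hp : p.WellPosed) (hs : p.LipschitzSmooth L) (hg : p.GradientNoise σ)
    (hb : p.DataHeterogeneity b) (hS : p.Sampling P ξ x₀)
    (hint : Integrable (fun ω => p.obj (x₀ ω)) P) (k : ℕ) :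
    Integrable (fun ω => p.obj (center p m γ s ξ x₀ k ω)) P ∧
    (∀ i, MemLp (fun ω => (deviation (randomState p m γ s ξ x₀ k ω)).1 i) 2 P) ∧
    ∀ i, MemLp (fun ω => (deviation (randomState p m γ s ξ x₀ k ω)).2 i) 2 P := by
  have hn := NeZero.pos n
  induction k with
  | zero =>
    refine ⟨?_, fun i => ?_, fun i => ?_⟩
    · simpa [center, randomState, iterates, mean_const hn] using hint
    all_goals simp [deviation, randomState, iterates, mean_const hn]
  | succ k ih =>
    obtain ⟨h0, h1, h2⟩ := ih
    have hq := memLp_queryPoint_sub h1 h2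
    have he := (memLp_sampledGradient_sub hn hp hs hg hb hS hq).1
    refine ⟨(descent hL hm hγ hLγ hp hs hg hS h0 hq).1, ?_⟩
    have hstep : ∀ ω, deviation (randomState p m γ s ξ x₀ (k + 1) ω) =
        if k < s then 0 else mix m (k % tau n) (deviation (randomState p m γ s ξ x₀ k ω) -
          γ • (fun i => sampledGradient p m γ s ξ x₀ k i ω -
              mean fun j => sampledGradient p m γ s ξ x₀ k j ω,
            fun i => sampledGradient p m γ s ξ x₀ k i ω -
              mean fun j => sampledGradient p m γ s ξ x₀ k j ω)) :=
      fun ω => deviation_iterates_succ hm s _ _ k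
    simp only [hstep]
    split_ifs
    · simp
    · exact memLp_mix _ (fun i => (h1 i).sub ((he i).const_smul γ))
        fun i => (h2 i).sub ((he i).const_smul γ)

theorem consensus_error_le (hn : 2 ≤ n) (hL : 0 < L) (hm : m.Allows n) (hγ : 0 ≤ γ)
    (hLγ : L * γ ≤ 1) (hsτ : s ≤ tau n) (hp : p.WellPosed) (hs : p.LipschitzSmooth L)
    (hg : p.GradientNoise σ) (hb : p.DataHeterogeneity b) (hS : p.Sampling P ξ x₀)
    (hint : Integrable (fun ω => p.obj (x₀ ω)) P) (k : ℕ) :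
    1 / (n : ℝ) * ∑ i, ∫ ω, ‖queryPoint p m γ s ξ x₀ k i ω - center p m γ s ξ x₀ k ω‖ ^ 2 ∂P ≤
      6 * γ ^ 2 * tau n * ∑ l ∈ Finset.Ico (k - 2 * tau n) k, (L ^ 2 * (1 / (n : ℝ) *
        ∑ i, ∫ ω, ‖queryPoint p m γ s ξ x₀ l i ω - center p m γ s ξ x₀ l ω‖ ^ 2 ∂P)
          + b ^ 2 + σ ^ 2) := by
  have hn0 : 0 < n := by omega
  have hn' : (0 : ℝ) < n := by positivity
  have hI := fun k => integrable_process (s := s) hL hm hγ hLγ hp hs hg hb hS hint k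
  have hq := fun k => memLp_queryPoint_sub (hI k).2.1 (hI k).2.2
  have he := fun k => memLp_sampledGradient_sub hn0 hp hs hg hb hS (hq k)
  have hle : ∀ ω, ∑ i, ‖queryPoint p m γ s ξ x₀ k i ω - center p m γ s ξ x₀ k ω‖ ^ 2 ≤
      2 * γ ^ 2 * tau n * ∑ l ∈ Finset.Ico (k - 2 * tau n) k,
        ∑ i, ‖sampledGradient p m γ s ξ x₀ l i ω -
          mean fun j => sampledGradient p m γ s ξ x₀ l j ω‖ ^ 2 :=
    fun ω => sum_norm_zArray_sub_mean_sq_le hn hm hγ hsτ _ _ k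
  have hIe : ∀ l, Integrable (fun ω => ∑ i, ‖sampledGradient p m γ s ξ x₀ l i ω -
      mean fun j => sampledGradient p m γ s ξ x₀ l j ω‖ ^ 2) P :=
    fun l => integrable_finsetSum _ fun i _ => ((he l).1 i).norm.integrable_sq
  have h1 := integral_mono
    (integrable_finsetSum Finset.univ fun i _ => (hq k i).norm.integrable_sq)
    ((integrable_finsetSum (Finset.Ico (k - 2 * tau n) k) fun l _ => hIe l).const_mul
      (2 * γ ^ 2 * tau n)) hle
  rw [integral_const_mul, integral_finsetSum _ fun i _ => (hq k i).norm.integrable_sq,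
    integral_finsetSum _ fun l _ => hIe l] at h1
  have h2 : ∀ l, ∫ ω, ∑ i, ‖sampledGradient p m γ s ξ x₀ l i ω -
      mean fun j => sampledGradient p m γ s ξ x₀ l j ω‖ ^ 2 ∂P ≤ 3 * n * (L ^ 2 * (1 / (n : ℝ) *
        ∑ i, ∫ ω, ‖queryPoint p m γ s ξ x₀ l i ω - center p m γ s ξ x₀ l ω‖ ^ 2 ∂P)
          + b ^ 2 + σ ^ 2) := by
    intro l
    rw [integral_finsetSum _ fun i _ => ((he l).1 i).norm.integrable_sq]
    refine (he l).2.trans (le_of_eq ?_)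
    field_simp
  have h3 : ∑ i, ∫ ω, ‖queryPoint p m γ s ξ x₀ k i ω - center p m γ s ξ x₀ k ω‖ ^ 2 ∂P ≤
      2 * γ ^ 2 * tau n * ∑ l ∈ Finset.Ico (k - 2 * tau n) k, 3 * n * (L ^ 2 * (1 / (n : ℝ) *
        ∑ i, ∫ ω, ‖queryPoint p m γ s ξ x₀ l i ω - center p m γ s ξ x₀ l ω‖ ^ 2 ∂P)
          + b ^ 2 + σ ^ 2) := by
    refine h1.trans ?_
    gcongr with l hl
    exact h2 l
  rw [← Finset.mul_sum] at h3
  rw [one_div_mul_eq_div, div_le_iff₀ hn']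
  refine h3.trans (le_of_eq ?_)
  ring

end RandomIterates

/-! ### Summation and the choice of the step size -/

section Rate

/-- After exchanging the sums, each `l` lies in the windows of at most `N` later indices. -/
theorem sum_sum_Ico_le {W : ℕ → ℝ} (hW : ∀ l, 0 ≤ W l) (N K : ℕ) :
    ∑ k ∈ Finset.range K, ∑ l ∈ Finset.Ico (k - N) k, W l ≤ N * ∑ l ∈ Finset.range K, W l := by
  have h1 : ∑ k ∈ Finset.range K, ∑ l ∈ Finset.Ico (k - N) k, W l =
      ∑ l ∈ Finset.range K, ∑ _k ∈ (Finset.range K).filter (fun k => k - N ≤ l ∧ l < k), W l := by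
    refine Finset.sum_comm' fun k l => ?_
    simp only [Finset.mem_range, Finset.mem_Ico, Finset.mem_filter]
    constructor
    · rintro ⟨h1, h2, h3⟩
      exact ⟨⟨h1, h2, h3⟩, by omega⟩
    · rintro ⟨⟨h1, h2, h3⟩, _⟩
      exact ⟨h1, h2, h3⟩
  rw [h1, Finset.mul_sum]
  refine Finset.sum_le_sum fun l _ => ?_
  rw [Finset.sum_const, nsmul_eq_mul]
  refine mul_le_mul_of_nonneg_right ?_ (hW l)
  have h2 : (Finset.range K).filter (fun k => k - N ≤ l ∧ l < k) ⊆ Finset.Ioc l (l + N) := by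
    intro k hk
    simp only [Finset.mem_filter, Finset.mem_Ioc] at hk ⊢
    omega
  have h3 := Finset.card_le_card h2
  rw [Nat.card_Ioc, Nat.add_sub_cancel_left] at h3
  exact_mod_cast h3

/-- With `S` the sum of the `V k`, summation gives `S ≤ 12 γ² t² (L² S + K c)`. The step size bound
makes `12 γ² t² L² ≤ 3/16`, and `12 / (13/16) < 15`. -/
theorem sum_consensus_le {V : ℕ → ℝ} {γ L c : ℝ} {t : ℕ} (hV : ∀ k, 0 ≤ V k) (hc : 0 ≤ c)
    (hγ : 64 * (γ * t * L) ^ 2 ≤ 1)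
    (h : ∀ k, V k ≤ 6 * γ ^ 2 * t * ∑ l ∈ Finset.Ico (k - 2 * t) k, (L ^ 2 * V l + c)) (K : ℕ) :
    ∑ k ∈ Finset.range K, V k ≤ 15 * γ ^ 2 * t ^ 2 * (K * c) := by
  have h1 := sum_sum_Ico_le (W := fun l => L ^ 2 * V l + c)
    (fun l => add_nonneg (mul_nonneg (sq_nonneg L) (hV l)) hc) (2 * t) K
  have h2 : ∑ k ∈ Finset.range K, V k ≤
      6 * γ ^ 2 * t * ((2 * t : ℕ) * ∑ l ∈ Finset.range K, (L ^ 2 * V l + c)) := by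
    refine (Finset.sum_le_sum fun k _ => h k).trans ?_
    rw [← Finset.mul_sum]
    exact mul_le_mul_of_nonneg_left h1 (by positivity)
  rw [Finset.sum_add_distrib, ← Finset.mul_sum, Finset.sum_const, Finset.card_range,
    nsmul_eq_mul] at h2
  push_cast at h2
  have h3 : 0 ≤ ∑ k ∈ Finset.range K, V k := Finset.sum_nonneg fun k _ => hV k
  have h4 := mul_le_mul_of_nonneg_right hγ h3
  have h5 : 0 ≤ γ ^ 2 * t ^ 2 * (K * c) := by positivity
  nlinarith

theorem average_le_of_descent {a V F : ℕ → ℝ} {γ L c v f : ℝ} {t K : ℕ} (hK : 0 < K)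
    (hγ0 : 0 < γ) (hV : ∀ k, 0 ≤ V k) (hc : 0 ≤ c) (hγ : 64 * (γ * t * L) ^ 2 ≤ 1)
    (h : ∀ k, V k ≤ 6 * γ ^ 2 * t * ∑ l ∈ Finset.Ico (k - 2 * t) k, (L ^ 2 * V l + c))
    (hF : ∀ k, F (k + 1) ≤ F k - γ / 2 * a k + γ / 2 * (L ^ 2 * V k) + L * γ ^ 2 / 2 * v)
    (hf : ∀ k, f ≤ F k) :
    1 / (K : ℝ) * ∑ k ∈ Finset.range K, a k ≤
      2 * (F 0 - f) / K * (1 / γ) + 15 * γ ^ 2 * t ^ 2 * L ^ 2 * c + L * γ * v := by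
  have h1 := sum_consensus_le hV hc hγ h K
  have h2 : γ / 2 * ∑ k ∈ Finset.range K, a k ≤ F 0 - F K +
      γ / 2 * L ^ 2 * ∑ k ∈ Finset.range K, V k + K * (L * γ ^ 2 / 2 * v) := by
    clear hK h1
    induction K with
    | zero => simp
    | succ K ih =>
      rw [Finset.sum_range_succ, Finset.sum_range_succ]
      push_cast
      linarith [hF K]
  have hK' : (0 : ℝ) < K := by positivity
  have h3 := mul_le_mul_of_nonneg_left h1 (by positivity : 0 ≤ γ / 2 * L ^ 2)
  have h4 : γ / 2 * ∑ k ∈ Finset.range K, a k ≤ F 0 - f +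
      γ / 2 * L ^ 2 * (15 * γ ^ 2 * t ^ 2 * (K * c)) + K * (L * γ ^ 2 / 2 * v) := by
    linarith [hf K]
  have h5 := mul_le_mul_of_nonneg_left h4 (by positivity : 0 ≤ 2 / (γ * K))
  calc 1 / (K : ℝ) * ∑ k ∈ Finset.range K, a k
      = 2 / (γ * K) * (γ / 2 * ∑ k ∈ Finset.range K, a k) := by field_simp
    _ ≤ _ := h5
    _ = _ := by field_simp

/-- Used with `D` a summand of `1 / γ`: excess powers of `D` cancel against those of `γ`. -/
theorem mul_pow_succ_le {γ D c : ℝ} (hγ : 0 ≤ γ) (hD : 0 ≤ D) (h : γ * D ≤ 1) (hc : 0 ≤ c)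
    (j : ℕ) : γ ^ j * (c * D ^ (j + 1)) ≤ c * D :=
  calc γ ^ j * (c * D ^ (j + 1)) = (γ * D) ^ j * (c * D) := by ring
    _ ≤ 1 * (c * D) := by
      gcongr
      exact pow_le_one₀ (mul_nonneg hγ hD) h
    _ = c * D := one_mul _

/-- At `x = 0` both sides are `0`, so a vanishing `σ` needs no separate case. -/
theorem rpow_neg_half_sq {x : ℝ} (hx : 0 ≤ x) : (x ^ (-(1 / 2) : ℝ)) ^ 2 = x⁻¹ := by
  rw [← Real.rpow_natCast, ← Real.rpow_mul hx, ← Real.rpow_neg_one]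
  norm_num

theorem rpow_neg_third_cube {x : ℝ} (hx : 0 ≤ x) : (x ^ (-(1 / 3) : ℝ)) ^ 3 = x⁻¹ := by
  rw [← Real.rpow_natCast, ← Real.rpow_mul hx, ← Real.rpow_neg_one]
  norm_num

variable {n T : ℕ} {L σ b Δ : ℝ}

theorem speedupTerm_nonneg (hL : 0 < L) (hΔ : 0 < Δ) : 0 ≤ speedupTerm n T L σ Δ :=
  Real.rpow_nonneg (by positivity) _

theorem middleTerm_nonneg : 0 ≤ middleTerm n T L σ b Δ :=
  Real.rpow_nonneg (by positivity) _

theorem lastTerm_nonneg (hL : 0 < L) (hΔ : 0 < Δ) : 0 ≤ lastTerm n T L Δ := by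
  unfold lastTerm
  positivity

theorem speedupTerm_sq (hL : 0 < L) (hΔ : 0 < Δ) :
    speedupTerm n T L σ Δ ^ 2 = Δ * L * σ ^ 2 / (n * (T + 1)) := by
  rw [speedupTerm, ← Real.rpow_natCast, ← Real.rpow_mul (by positivity)]
  norm_num

theorem middleTerm_cube : middleTerm n T L σ b Δ ^ 3 =
    Δ ^ 2 * L ^ 2 * (tau n : ℝ) ^ 2 * (σ ^ 2 + 2 * b ^ 2) / (T + 1) ^ 2 := by
  rw [middleTerm, ← Real.rpow_natCast, ← Real.rpow_mul (by positivity)]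
  norm_num

/-- The summands satisfy `D₁² = L σ² K / (2nΔ)` and `D₂³ = 24 L² τ² (σ² + 2b²) K / Δ`. They turn the
noise term into at most `2 (Δ/K) D₁` and the consensus term into at most `(Δ/K) D₂`, giving `4 (Δ/K)
D₁ + 3 (Δ/K) D₂` plus the last term. -/
theorem stepSize_bounds (hn : 2 ≤ n) (hL : 0 < L) (hΔ : 0 < Δ) :
    0 < stepSize n T L σ b Δ ∧ L * stepSize n T L σ b Δ ≤ 1 ∧
    64 * (stepSize n T L σ b Δ * tau n * L) ^ 2 ≤ 1 ∧
    2 * Δ / (T + 1) * (1 / stepSize n T L σ b Δ) +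
      15 * stepSize n T L σ b Δ ^ 2 * (tau n : ℝ) ^ 2 * L ^ 2 * (b ^ 2 + σ ^ 2) +
      L * stepSize n T L σ b Δ * (σ ^ 2 / n) ≤
    4 * speedupTerm n T L σ Δ + 9 * middleTerm n T L σ b Δ + 16 * lastTerm n T L Δ := by
  have hn' : (0 : ℝ) < n := by positivity
  have hτ : (1 : ℝ) ≤ tau n := by exact_mod_cast tau_pos hn
  have hX : 0 ≤ 2 * n * Δ / (L * σ ^ 2 * (T + 1)) := by positivity
  have hY : 0 ≤ Δ / (24 * L ^ 2 * (tau n : ℝ) ^ 2 * (σ ^ 2 + 2 * b ^ 2) * (T + 1)) := by positivity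
  have hD1 := rpow_neg_half_sq hX
  have hD2 := rpow_neg_third_cube hY
  have hD1n := Real.rpow_nonneg hX (-(1 / 2))
  have hD2n := Real.rpow_nonneg hY (-(1 / 3))
  rw [inv_div] at hD1 hD2
  unfold stepSize
  set D₁ := (2 * n * Δ / (L * σ ^ 2 * (T + 1))) ^ (-(1 / 2) : ℝ)
  set D₂ := (Δ / (24 * L ^ 2 * (tau n : ℝ) ^ 2 * (σ ^ 2 + 2 * b ^ 2) * (T + 1))) ^ (-(1 / 3) : ℝ)
  set t : ℝ := (tau n : ℝ) with ht
  set K : ℝ := (T : ℝ) + 1 with hK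
  have hK0 : 0 < K := by positivity
  have htL : 0 < t * L := by positivity
  have hden : 0 < D₁ + D₂ + 8 * t * L := by linarith only [hD1n, hD2n, htL]
  set γ := 1 / (D₁ + D₂ + 8 * t * L) with hγ
  have hγ0 : 0 < γ := by positivity
  have hγden : γ * (D₁ + D₂ + 8 * t * L) = 1 := by rw [hγ]; field_simp
  have hγinv : 1 / γ = D₁ + D₂ + 8 * t * L := one_div_one_div _
  clear_value γ D₁ D₂
  have hle : ∀ q, q ≤ D₁ + D₂ + 8 * t * L → γ * q ≤ 1 := fun q hq =>
    (mul_le_mul_of_nonneg_left hq hγ0.le).trans_eq hγden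
  have hγ1 : γ * D₁ ≤ 1 := hle _ (by linarith only [hD2n, htL])
  have hγ2 : γ * D₂ ≤ 1 := hle _ (by linarith only [hD1n, htL])
  have hγ3 : γ * (8 * (t * L)) ≤ 1 := hle _ (by linarith only [hD1n, hD2n])
  have hγ4 : γ * L ≤ 1 :=
    hle _ (by linarith only [hD1n, hD2n, hL, mul_le_mul_of_nonneg_right hτ hL.le])
  have hS := speedupTerm_sq (n := n) (T := T) (σ := σ) hL hΔ
  have hM := middleTerm_cube (n := n) (T := T) (L := L) (σ := σ) (b := b) (Δ := Δ)
  rw [← hK] at hS hM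
  rw [← ht] at hM
  have h1 : Δ / K * D₁ ≤ speedupTerm n T L σ Δ := by
    refine le_of_pow_le_pow_left₀ two_ne_zero (speedupTerm_nonneg hL hΔ) ?_
    rw [mul_pow, hD1, hS, ← sub_nonneg]
    have : Δ * L * σ ^ 2 / (n * K) - (Δ / K) ^ 2 * (L * σ ^ 2 * K / (2 * n * Δ)) =
        Δ * L * σ ^ 2 / (2 * n * K) := by field_simp; ring
    rw [this]
    positivity
  -- The cube of the left side is `24` times the cube of the middle term, and `24 ≤ 3 ^ 3`.
  have h2 : Δ / K * D₂ ≤ 3 * middleTerm n T L σ b Δ := by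
    refine le_of_pow_le_pow_left₀ (n := 3) (by norm_num) (mul_nonneg (by norm_num)
      middleTerm_nonneg) ?_
    rw [mul_pow, hD2, mul_pow, hM, ← sub_nonneg]
    have : 3 ^ 3 * (Δ ^ 2 * L ^ 2 * t ^ 2 * (σ ^ 2 + 2 * b ^ 2) / K ^ 2) -
        (Δ / K) ^ 3 * (24 * L ^ 2 * t ^ 2 * (σ ^ 2 + 2 * b ^ 2) * K / Δ) =
        3 * (Δ ^ 2 * L ^ 2 * t ^ 2 * (σ ^ 2 + 2 * b ^ 2) / K ^ 2) := by field_simp; ring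
    rw [this]
    positivity
  have h3 : L * γ * (σ ^ 2 / n) ≤ 2 * (Δ / K * D₁) := by
    have h : L * (σ ^ 2 / n) = 2 * (Δ / K) * D₁ ^ 2 := by rw [hD1]; field_simp
    have h' := mul_pow_succ_le hγ0.le hD1n hγ1 (by positivity : 0 ≤ 2 * (Δ / K)) 1
    rw [pow_one, ← h] at h'
    linarith only [h']
  have h4 : 15 * γ ^ 2 * t ^ 2 * L ^ 2 * (b ^ 2 + σ ^ 2) ≤ Δ / K * D₂ := by
    have h : 24 * L ^ 2 * t ^ 2 * (σ ^ 2 + 2 * b ^ 2) = Δ / K * D₂ ^ 3 := by rw [hD2]; field_simp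
    have h6 := mul_pow_succ_le hγ0.le hD2n hγ2 (by positivity : 0 ≤ Δ / K) 2
    rw [← h] at h6
    have h7 : 0 ≤ γ ^ 2 * t ^ 2 * L ^ 2 * σ ^ 2 := by positivity
    have h8 : 0 ≤ γ ^ 2 * t ^ 2 * L ^ 2 * b ^ 2 := by positivity
    linarith only [h6, h7, h8]
  refine ⟨hγ0, by rwa [mul_comm], ?_, ?_⟩
  · calc 64 * (γ * t * L) ^ 2 = (γ * (8 * (t * L))) ^ 2 := by ring
      _ ≤ 1 := pow_le_one₀ (by positivity) hγ3
  · have h5 : 2 * Δ / K * (1 / γ) = 2 * (Δ / K * D₁) + 2 * (Δ / K * D₂) +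
        16 * lastTerm n T L Δ := by
      rw [hγinv, lastTerm, ← ht, ← hK]
      ring
    rw [h5]
    linarith only [h1, h2, h3, h4]

/-! ### The transient iteration count -/

theorem tau_le_two_mul_logb (hn : 2 ≤ n) :
    1 ≤ Real.logb 2 n ∧ (tau n : ℝ) ≤ 2 * Real.logb 2 n := by
  have h1 : 1 ≤ Real.logb 2 n := by
    rw [Real.le_logb_iff_rpow_le (by norm_num) (by positivity), Real.rpow_one]
    exact_mod_cast hn
  refine ⟨h1, ?_⟩
  have h2 := Real.natCeil_logb_natCast 2 n
  have h3 := Nat.ceil_lt_add_one (a := Real.logb 2 n) (by linarith)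
  rw [Nat.cast_ofNat] at h2
  rw [h2] at h3
  unfold tau
  linarith

/-- The constant in the transient iteration count. -/
noncomputable def transientConst (L σ b Δ : ℝ) : ℝ :=
  729 * 16 * (Δ * L * (σ ^ 2 + 2 * b ^ 2) ^ 2) / σ ^ 6 + 64 * (Δ * L) / σ ^ 2 + 1

/-- The summand `1` keeps the constant positive at `σ = 0`, where both quotients are `0`. -/
theorem transientConst_pos (hL : 0 < L) (hΔ : 0 < Δ) : 0 < transientConst L σ b Δ := by
  unfold transientConst
  positivity

/-- It suffices that three middle terms, and likewise four last terms, stay below the speedup term.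
Sixth powers turn the former into `729 Δ L τ⁴ B² n³ ≤ σ⁶ K`, the origin of `n³ log₂⁴ n`; squares
turn the latter into `16 Δ L τ² n ≤ σ² K`. -/
theorem speedupTerm_dominates (hn : 2 ≤ n) (hL : 0 < L) (hΔ : 0 < Δ) (hσ : 0 < σ)
    (hT : transientConst L σ b Δ * (n : ℝ) ^ 3 * Real.logb 2 n ^ 4 ≤ T) :
    24 * middleTerm n T L σ b Δ + 32 * lastTerm n T L Δ ≤ 16 * speedupTerm n T L σ Δ := by
  obtain ⟨hl, hτ⟩ := tau_le_two_mul_logb hn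
  have hn1 : (1 : ℝ) ≤ n := by exact_mod_cast (by omega : 1 ≤ n)
  have hS := speedupTerm_sq (n := n) (T := T) (σ := σ) hL hΔ
  have hM := middleTerm_cube (n := n) (T := T) (L := L) (σ := σ) (b := b) (Δ := Δ)
  have hS0 := speedupTerm_nonneg (n := n) (T := T) (σ := σ) hL hΔ
  have hlast : lastTerm n T L Δ = tau n * Δ * L / (T + 1) := rfl
  have hlast0 := lastTerm_nonneg (n := n) (T := T) hL hΔ
  have ht0 : (0 : ℝ) ≤ tau n := Nat.cast_nonneg _
  set t : ℝ := (tau n : ℝ)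
  set ℓ := Real.logb 2 n
  set K : ℝ := (T : ℝ) + 1 with hK
  set B := σ ^ 2 + 2 * b ^ 2 with hB
  have hK0 : 0 < K := by positivity
  have hTK : transientConst L σ b Δ * (n : ℝ) ^ 3 * ℓ ^ 4 ≤ K := by linarith
  have hpos : 0 ≤ (n : ℝ) ^ 3 * ℓ ^ 4 := by positivity
  have e1 : 0 ≤ 729 * 16 * (Δ * L * B ^ 2) / σ ^ 6 := by positivity
  have e2 : 0 ≤ 64 * (Δ * L) / σ ^ 2 := by positivity
  have hC1 : 729 * 16 * (Δ * L * B ^ 2) / σ ^ 6 * ((n : ℝ) ^ 3 * ℓ ^ 4) ≤ K := by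
    rw [mul_assoc] at hTK
    refine le_trans (mul_le_mul_of_nonneg_right ?_ hpos) hTK
    unfold transientConst
    linarith
  have hC2 : 64 * (Δ * L) / σ ^ 2 * ((n : ℝ) ^ 3 * ℓ ^ 4) ≤ K := by
    rw [mul_assoc] at hTK
    refine le_trans (mul_le_mul_of_nonneg_right ?_ hpos) hTK
    unfold transientConst
    linarith
  rw [div_mul_eq_mul_div, div_le_iff₀ (by positivity)] at hC1 hC2
  have k1 : 729 * (Δ * L) * t ^ 4 * B ^ 2 * (n : ℝ) ^ 3 ≤ σ ^ 6 * K := by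
    have : t ^ 4 ≤ 16 * ℓ ^ 4 := by
      calc t ^ 4 ≤ (2 * ℓ) ^ 4 := pow_le_pow_left₀ ht0 hτ 4
        _ = _ := by ring
    calc _ = (729 * (Δ * L) * B ^ 2 * (n : ℝ) ^ 3) * t ^ 4 := by ring
      _ ≤ (729 * (Δ * L) * B ^ 2 * (n : ℝ) ^ 3) * (16 * ℓ ^ 4) := by gcongr
      _ = 729 * 16 * (Δ * L * B ^ 2) * ((n : ℝ) ^ 3 * ℓ ^ 4) := by ring
      _ ≤ _ := by linarith
  have k2 : 16 * (Δ * L) * t ^ 2 * n ≤ σ ^ 2 * K := by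
    have h1 : t ^ 2 ≤ 4 * ℓ ^ 4 := by
      calc t ^ 2 ≤ (2 * ℓ) ^ 2 := pow_le_pow_left₀ ht0 hτ 2
        _ = 4 * ℓ ^ 2 := by ring
        _ ≤ 4 * ℓ ^ 4 := by gcongr; norm_num
    have h2 : (n : ℝ) ≤ (n : ℝ) ^ 3 := le_self_pow₀ hn1 (by norm_num)
    calc _ ≤ 16 * (Δ * L) * (4 * ℓ ^ 4) * (n : ℝ) ^ 3 := by gcongr
      _ = 64 * (Δ * L) * ((n : ℝ) ^ 3 * ℓ ^ 4) := by ring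
      _ ≤ _ := by linarith
  have h1 : 3 * middleTerm n T L σ b Δ ≤ speedupTerm n T L σ Δ := by
    refine le_of_pow_le_pow_left₀ (n := 6) (by norm_num) hS0 ?_
    calc (3 * middleTerm n T L σ b Δ) ^ 6 = 729 * (middleTerm n T L σ b Δ ^ 3) ^ 2 := by ring
      _ = (Δ * L) ^ 3 / (n ^ 3 * K ^ 4) * (729 * (Δ * L) * t ^ 4 * B ^ 2 * (n : ℝ) ^ 3) := by
        rw [hM]; field_simp
      _ ≤ (Δ * L) ^ 3 / (n ^ 3 * K ^ 4) * (σ ^ 6 * K) := by gcongr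
      _ = (speedupTerm n T L σ Δ ^ 2) ^ 3 := by rw [hS]; field_simp
      _ = _ := by ring
  have h2 : 4 * lastTerm n T L Δ ≤ speedupTerm n T L σ Δ := by
    refine le_of_pow_le_pow_left₀ two_ne_zero hS0 ?_
    calc (4 * lastTerm n T L Δ) ^ 2 = Δ * L / (n * K ^ 2) * (16 * (Δ * L) * t ^ 2 * n) := by
          rw [hlast]; field_simp; ring
      _ ≤ Δ * L / (n * K ^ 2) * (σ ^ 2 * K) := by gcongr
      _ = _ := by rw [hS]; field_simp
  linarith

end Rate

/-! ### Assembly of the rate -/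

theorem average_gradient_le {n d T s : ℕ} [NeZero n] {Ω Ξ : Type*} [MeasurableSpace Ω]
    [MeasurableSpace Ξ] {P : Measure Ω} [IsProbabilityMeasure P] {p : Problem n d Ξ}
    {m : PortModel} {L σ b Δ : ℝ} {ξ : ℕ → Fin n → Ω → Ξ} {x₀ : Ω → Vec d} (hn : 2 ≤ n)
    (hL : 0 < L) (hΔ : 0 < Δ) (hm : m.Allows n) (hsτ : s ≤ tau n) (hp : p.WellPosed)
    (hs : p.LipschitzSmooth L) (hg : p.GradientNoise σ) (hb : p.DataHeterogeneity b)
    (hS : p.Sampling P ξ x₀) (hint : Integrable (fun ω => p.obj (x₀ ω)) P)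
    (hΔ' : Δ = (∫ ω, p.obj (x₀ ω) ∂P) - p.fStar) :
    (∀ k, Integrable (fun ω => ‖gradient p.obj
      (center p m (stepSize n T L σ b Δ) s ξ x₀ k ω)‖ ^ 2) P) ∧
    (1 / ((T : ℝ) + 1)) * ∑ k ∈ Finset.range (T + 1), ∫ ω, ‖gradient p.obj
      (center p m (stepSize n T L σ b Δ) s ξ x₀ k ω)‖ ^ 2 ∂P ≤
      4 * speedupTerm n T L σ Δ + 9 * middleTerm n T L σ b Δ + 16 * lastTerm n T L Δ := by
  obtain ⟨hγ0, hLγ, hγ, hrate⟩ := stepSize_bounds (T := T) (σ := σ) (b := b) hn hL hΔ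
  set γ := stepSize n T L σ b Δ
  have hn0 := NeZero.pos n
  have hI := fun k => integrable_process (s := s) hL hm hγ0.le hLγ hp hs hg hb hS hint k
  refine ⟨fun k => (memLp_gradient_obj hL hn0 hp hs (measurable_center hp hS.measurable_init
    fun l _ j => hS.measurable_sample l j) (hI k).1).norm.integrable_sq, ?_⟩
  have h := average_le_of_descent (K := T + 1) (t := tau n) (c := b ^ 2 + σ ^ 2)
    (a := fun k => ∫ ω, ‖gradient p.obj (center p m γ s ξ x₀ k ω)‖ ^ 2 ∂P)
    (V := fun k => 1 / (n : ℝ) *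
      ∑ i, ∫ ω, ‖queryPoint p m γ s ξ x₀ k i ω - center p m γ s ξ x₀ k ω‖ ^ 2 ∂P)
    (F := fun k => ∫ ω, p.obj (center p m γ s ξ x₀ k ω) ∂P) (v := σ ^ 2 / n) (f := p.fStar)
    (Nat.succ_pos T) hγ0
    (fun k => mul_nonneg (by positivity) (Finset.sum_nonneg fun i _ =>
      integral_nonneg fun ω => by positivity)) (by positivity) hγ (fun k => ?_)
    (fun k => (descent hL hm hγ0.le hLγ hp hs hg hS (hI k).1
      (memLp_queryPoint_sub (hI k).2.1 (hI k).2.2)).2) fun k => ?_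
  · have h0 : ∀ ω, center p m γ s ξ x₀ 0 ω = x₀ ω := fun ω => mean_const hn0 _
    simp only [h0, ← hΔ'] at h
    push_cast at h
    exact h.trans hrate
  · have h1 := consensus_error_le hn hL hm hγ0.le hLγ hsτ hp hs hg hb hS hint k
    simpa only [add_assoc] using h1
  · have h1 := integral_mono (integrable_const p.fStar) (hI k).1 fun ω => hp.fStar_le _
    simpa using h1

end DSGDCECA

theorem mainTheorem1 (L σ b Δ : ℝ) (hL : 0 < L) (hσ : 0 ≤ σ) (hb : 0 ≤ b) (hΔ : 0 < Δ) :
    -- `C` depends only on `L, σ, b, Δ`; it is used only in the transient iteration count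
    ∃ C : ℝ, 0 < C ∧
      ∀ (n d T s : ℕ) (m : DSGDCECA.PortModel), 2 ≤ n → m.Allows n →
      -- the global averaging phase makes `x_i^(k)` and `y_i^(k)` independent of `i` for `k < τ`
      (s = DSGDCECA.tau n ∨ s + 1 = DSGDCECA.tau n) →
      ∀ (Ω Ξ : Type*) [MeasurableSpace Ω] [MeasurableSpace Ξ]
        (P : MeasureTheory.Measure Ω) [MeasureTheory.IsProbabilityMeasure P]
        (p : DSGDCECA.Problem n d Ξ) (ξ : ℕ → Fin n → Ω → Ξ) (x₀ : Ω → DSGDCECA.Vec d),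
      p.WellPosed → p.LipschitzSmooth L → p.GradientNoise σ → p.DataHeterogeneity b →
      p.Sampling P ξ x₀ →
      MeasureTheory.Integrable (fun ω => p.obj (x₀ ω)) P →
      Δ = (∫ ω, p.obj (x₀ ω) ∂P) - p.fStar →
      ∀ xbar : ℕ → Ω → DSGDCECA.Vec d,
      (∀ k ω, xbar k ω = DSGDCECA.mean (DSGDCECA.iterates p m
        (DSGDCECA.stepSize n T L σ b Δ) s (fun l i => ξ l i ω) (x₀ ω) k).x) →
      -- the convergence rate
      (∀ k ≤ T, MeasureTheory.Integrable (fun ω => ‖gradient p.obj (xbar k ω)‖ ^ 2) P) ∧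
      (1 / ((T : ℝ) + 1)) * ∑ k ∈ Finset.range (T + 1), ∫ ω, ‖gradient p.obj (xbar k ω)‖ ^ 2 ∂P
        ≤ 16 * DSGDCECA.speedupTerm n T L σ Δ + 24 * DSGDCECA.middleTerm n T L σ b Δ
          + 32 * DSGDCECA.lastTerm n T L Δ ∧
      -- after `O(n³ log₂⁴ n)` iterations the linear speedup term dominates
      (0 < σ → C * (n : ℝ) ^ 3 * Real.logb 2 n ^ 4 ≤ T →
        24 * DSGDCECA.middleTerm n T L σ b Δ + 32 * DSGDCECA.lastTerm n T L Δ
          ≤ 16 * DSGDCECA.speedupTerm n T L σ Δ ∧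
        (1 / ((T : ℝ) + 1)) *
            ∑ k ∈ Finset.range (T + 1), ∫ ω, ‖gradient p.obj (xbar k ω)‖ ^ 2 ∂P
          ≤ 32 * DSGDCECA.speedupTerm n T L σ Δ) := by
  refine ⟨DSGDCECA.transientConst L σ b Δ, DSGDCECA.transientConst_pos hL hΔ, ?_⟩
  intro n d T s m hn hm hsτ Ω Ξ _ _ P _ p ξ x₀ hp hs hg hb hS hint hΔ' xbar hxbar
  have : NeZero n := ⟨by omega⟩
  have hle : s ≤ DSGDCECA.tau n := by omega
  have hx : xbar = DSGDCECA.center p m (DSGDCECA.stepSize n T L σ b Δ) s ξ x₀ :=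
    funext fun k => funext fun ω => hxbar k ω
  subst hx
  obtain ⟨hI, hrate⟩ := DSGDCECA.average_gradient_le (T := T) hn hL hΔ hm hle hp hs hg hb
    hS hint hΔ'
  have h1 := DSGDCECA.speedupTerm_nonneg (n := n) (T := T) (σ := σ) hL hΔ
  have h2 := DSGDCECA.middleTerm_nonneg (n := n) (T := T) (L := L) (σ := σ) (b := b) (Δ := Δ)
  have h3 := DSGDCECA.lastTerm_nonneg (n := n) (T := T) hL hΔ
  refine ⟨fun k _ => hI k, hrate.trans (by linarith), fun hσ0 hT => ?_⟩
  have h4 := DSGDCECA.speedupTerm_dominates hn hL hΔ hσ0 hT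
  exact ⟨h4, hrate.trans (by linarith)⟩
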